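/- Let $X_1,X_2,\dots$ be independent real random variables with common density $f$ and distribution function $F(x)=\int_{-\infty}^x f$, and let $k:\mathbb R\to\mathbb R$ be an integrable kernel with $\int k=1$ and $K(x)=\int_{-\infty}^x k(y)\,dy$. For $h>0$ and $n\ge 1$ let $F_{nh}(x)=n^{-1}\sum_{j=1}^n K\big((x-X_j)/h\big)$, and let $F_{n0}$ be the empirical distribution function of $X_1,\dots,X_n$. Put $$\mathrm{MISE}_n(h)=\mathbb E\int_{-\infty}^{\infty}\{F_{nh}(x)-F(x)\}^2\,dx,\qquad \mathrm{ISB}(h)=\int_{-\infty}^{\infty}\{\mathbb E[F_{nh}(x)]-F(x)\}^2\,dx$$ (the latter does not depend on $n$), $\psi(G)=\int_{-\infty}^{\infty} G(1-G)$, $\varphi_g(t)=\int e^{itx}g(x)\,dx$, and, in $[0,\infty]$, $$C_f=\sup\{r\ge 0:\varphi_f(t)\ne 0\text{ for a.e. }t\in[0,r]\},\qquad D_f=\sup\{t\ge 0:\varphi_f(t)\neq 0\},$$ $$S_k=\inf\{t\ge 0:\varphi_k(t)\ne 1\},\qquad T_k=\inf\{r\ge 0:\varphi_k(t)\neq 1\text{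 for a.e. }t\ge r\}.$$ An optimal bandwidth $h_{0n}$ is a minimizer of $\mathrm{MISE}_n$ over $(0,\infty)$. **Theorem.** Assume $\int|x|\,dF(x)<\infty$, $\int|y\,k(y)|\,dy<\infty$, $\psi(K)>0$, $C_f=D_f$ and $S_k=T_k$. Then $S_k/D_f$ is finite (it is $0$ if $D_f=\infty$), and: 1. for every $n\ge1$ an optimal bandwidth $h_{0n}$ exists, and for every choice of optimal bandwidths $h_{0n}\to S_k/D_f$ as $n\to\infty$; 2. $h_*:=\sup\{h\ge 0:\mathrm{ISB}(h)=0\}=S_k/D_f$; 3. for every $n\ge 1$ and every $h\in[0,S_k/D_f]$, $\mathrm{MISE}_n(h)$ is finite and $\mathrm{MISE}_n(h)=n^{-1}\{\psi(F)-\psi(K)h\}$; 4. for every $h\in(0,S_k/D_f]$ one has $0<\psi(F)-\psi(K)h<\psi(F)$, hence $\mathrm{MISE}_n(h)<\mathrm{MISE}_n(0)$ for every $n\ge1$: the MISE of $F_{nh}$ is of order $n^{-1}$, as for the empirical distribution function, but with a strictly smaller constant. -/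

import Mathlib

open MeasureTheory ProbabilityTheory Filter Topology
open scoped ENNReal

noncomputable section

/-- The Fourier transform `φ_g(t) = ∫ e^{itx} g(x) dx`. -/
def fourierTr (g : ℝ → ℝ) (t : ℝ) : ℂ :=
  ∫ x : ℝ, Complex.exp (Complex.I * t * x) * (g x : ℂ)

/-- `G(x) = ∫_{-∞}^x g(y) dy`: the distribution function of a density `g`, or the integrated
kernel of a kernel `g`. -/
def integrated (g : ℝ → ℝ) (x : ℝ) : ℝ := ∫ y in Set.Iic x, g y

/-- `ψ(G) = ∫ G (1 - G)`, where `G` is the primitive `integrated g`. -/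
def psi (g : ℝ → ℝ) : ℝ := ∫ x : ℝ, integrated g x * (1 - integrated g x)

/-- `C_f = sup {r ≥ 0 : φ_f(t) ≠ 0 for a.e. t ∈ [0, r]}`, in `[0, ∞]`. -/
def freqC (f : ℝ → ℝ) : ℝ≥0∞ :=
  sSup (ENNReal.ofReal '' {r : ℝ | 0 ≤ r ∧ ∀ᵐ t : ℝ, t ∈ Set.Icc 0 r → fourierTr f t ≠ 0})

/-- `D_f = sup {t ≥ 0 : φ_f(t) ≠ 0}`, in `[0, ∞]`. -/
def freqD (f : ℝ → ℝ) : ℝ≥0∞ :=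
  sSup (ENNReal.ofReal '' {t : ℝ | 0 ≤ t ∧ fourierTr f t ≠ 0})

/-- `S_k = inf {t ≥ 0 : φ_k(t) ≠ 1}`, in `[0, ∞]`. -/
def freqS (k : ℝ → ℝ) : ℝ≥0∞ :=
  sInf (ENNReal.ofReal '' {t : ℝ | 0 ≤ t ∧ fourierTr k t ≠ 1})

/-- `T_k = inf {r ≥ 0 : φ_k(t) ≠ 1 for a.e. t ≥ r}`, in `[0, ∞]`. -/
def freqT (k : ℝ → ℝ) : ℝ≥0∞ :=
  sInf (ENNReal.ofReal '' {r : ℝ | 0 ≤ r ∧ ∀ᵐ t : ℝ, r ≤ t → fourierTr k t ≠ 1})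

/-- The empirical distribution function of the first `n` terms of `s`, evaluated at `x`. -/
def empiricalCDF (n : ℕ) (s : ℕ → ℝ) (x : ℝ) : ℝ :=
  (n : ℝ)⁻¹ * ∑ j ∈ Finset.range n, (Set.Ici (s j)).indicator (fun _ => (1 : ℝ)) x

/-- The kernel distribution function estimator `n⁻¹ ∑ K((x - X_j) / h)` with bandwidth `h`;
for `h = 0` it is the empirical distribution function. -/
def kernelCDF (k : ℝ → ℝ) (n : ℕ) (h : ℝ) (s : ℕ → ℝ) (x : ℝ) : ℝ :=
  if h = 0 then empiricalCDF n s x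
  else (n : ℝ)⁻¹ * ∑ j ∈ Finset.range n, integrated k (h⁻¹ * (x - s j))

/-- `MISE_n(h) = E ∫ (F_{nh}(x) - F(x))² dx`, in `[0, ∞]`. -/
def mise {Ω : Type*} [MeasurableSpace Ω] (P : Measure Ω) (X : ℕ → Ω → ℝ)
    (f k : ℝ → ℝ) (n : ℕ) (h : ℝ) : ℝ≥0∞ :=
  ∫⁻ ω, (∫⁻ x : ℝ,
    ENNReal.ofReal ((kernelCDF k n h (fun j => X j ω) x - integrated f x) ^ 2)) ∂P

/-- The integrated squared bias `ISB(h) = ∫ (E[F_{nh}(x)] - F(x))² dx`, in `[0, ∞]`. -/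
def isb {Ω : Type*} [MeasurableSpace Ω] (P : Measure Ω) (X : ℕ → Ω → ℝ)
    (f k : ℝ → ℝ) (n : ℕ) (h : ℝ) : ℝ≥0∞ :=
  ∫⁻ x : ℝ,
    ENNReal.ofReal (((∫ ω, kernelCDF k n h (fun j => X j ω) x ∂P) - integrated f x) ^ 2)

/-- `h_* = sup {h ≥ 0 : ISB(h) = 0}`, in `[0, ∞]`. -/
def hStar {Ω : Type*} [MeasurableSpace Ω] (P : Measure Ω) (X : ℕ → Ω → ℝ)
    (f k : ℝ → ℝ) (n : ℕ) : ℝ≥0∞ :=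
  sSup (ENNReal.ofReal '' {h : ℝ | 0 ≤ h ∧ isb P X f k n h = 0})

/-- `h` is a MISE-optimal bandwidth for sample size `n`: it minimizes `MISE_n` over `(0, ∞)`. -/
def IsOptimalBandwidth {Ω : Type*} [MeasurableSpace Ω] (P : Measure Ω) (X : ℕ → Ω → ℝ)
    (f k : ℝ → ℝ) (n : ℕ) (h : ℝ) : Prop :=
  0 < h ∧ ∀ h' : ℝ, 0 < h' → mise P X f k n h ≤ mise P X f k n h'

end

/-!
The summands of `F_{nh}(x)` are independent copies of `K((x - X) / h)`, so the mean square error at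
`x` is squared bias plus `1/n` times the variance of one summand. Integrating over `x` gives

  `MISE_n(h) = ISB(h) + n⁻¹ (ψ(F) - ψ(K) h + R(h) - ISB(h))`,

where `R(h) = ∫ b (1 - 2 F)` is the derivative of `ψ` at `F` in the direction of the bias `b`: the
variance of a summand is `m (1 - m)` minus the mean of `K (1 - K)`, with `m = F + b`, and the latter
integrates to `ψ(K) h` (`integral_stepVar`, `mise_eq`). In particular `R` vanishes together with
the bias, and then `MISE_n(h) = n⁻¹ (ψ(F) - ψ(K) h)`. The integrated variance is positive for
`h > 0`, since otherwise `K` would be periodic (`intVar_pos`).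

The bias is `b(x) = ∫ k(y) (F(x - h y) - F(x)) dy`, and `F(· - a) - F` is the convolution of the
density with a difference of two steps. Its `L¹` norm is `|a|`, which makes `ISB` and `R` Lipschitz
in `h`; its Fourier transform is explicit, and that of the bias satisfies
`i t b̂(t) = -φ_f(t) (φ_k(h t) - 1)`. So the bias vanishes if and only if `φ_k(h t) = 1` wherever
`φ_f(t) ≠ 0`, and under `C_f = D_f` and `S_k = T_k` this says `h ≤ S_k / D_f`
(`sqBias_eq_zero_iff_le`).

For small `h`, translation invariance of `ψ` gives `R(h) = ∫ k(y) B(h y) dy` with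
`B(a) = ∫ (F(x - a) - F(x))² dx`, and `ISB(h)` is bounded by the same kind of integral. As
`B(a) = o(a)`, both are `o(h)`, so the gain `ψ(K) h / n` dominates and some `h > 0` beats `h = 0`
(`exists_miseReal_lt`). For large `h` the mean of the estimator approaches the constant `K(0)`, and
`ISB` explodes by Fatou's lemma (`tendsto_sqBias_atTop`). With continuity this yields minimizers
over `(0, ∞)`. They are at least `S_k / D_f`, because the risk decreases strictly up to that point;
their integrated squared bias is at most `ψ(F) / n`, while `ISB` is bounded below by a positive
constant on `[S_k / D_f + ε, ∞)`.
-/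

/-! ### Primitives of integrable functions -/

lemma continuous_integrated {q : ℝ → ℝ} (hq : Integrable q) : Continuous (integrated q) := by
  have : integrated q = fun x => (∫ y in Set.Iic 0, q y) + ∫ y in (0 : ℝ)..x, q y := by
    ext x
    rw [← intervalIntegral.integral_Iic_sub_Iic hq.integrableOn hq.integrableOn]
    simp [integrated]
  rw [this]
  exact continuous_const.add
    (intervalIntegral.continuous_primitive (fun a b => hq.intervalIntegrable) 0)

lemma abs_integrated_le {q : ℝ → ℝ} (hq : Integrable q) (x : ℝ) :
    |integrated q x| ≤ ∫ y, |q y| :=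
  (abs_integral_le_integral_abs).trans
    (setIntegral_le_integral hq.abs (ae_of_all _ fun _ => abs_nonneg _))

lemma tendsto_integrated_atBot {q : ℝ → ℝ} : Tendsto (integrated q) atBot (𝓝 0) :=
  tendsto_integral_Iic_zero tendsto_id

lemma tendsto_integrated_atTop {q : ℝ → ℝ} (hq : Integrable q) :
    Tendsto (integrated q) atTop (𝓝 (∫ y, q y)) :=
  (aecover_Iic tendsto_id).integral_tendsto_of_countably_generated hq

lemma monotone_integrated {q : ℝ → ℝ} (hq : Integrable q) (h0 : ∀ x, 0 ≤ q x) :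
    Monotone (integrated q) := fun _ _ hab =>
  setIntegral_mono_set hq.integrableOn (ae_of_all _ h0) (Set.Iic_subset_Iic.2 hab).eventuallyLE

lemma integrated_nonneg {q : ℝ → ℝ} (h0 : ∀ x, 0 ≤ q x) (x : ℝ) : 0 ≤ integrated q x :=
  integral_nonneg h0

lemma integrated_le_integral {q : ℝ → ℝ} (hq : Integrable q) (h0 : ∀ x, 0 ≤ q x) (x : ℝ) :
    integrated q x ≤ ∫ y, q y :=
  setIntegral_le_integral hq (ae_of_all _ h0)

/-- The difference `1[a ≤ w] - 1[0 ≤ w]` of two unit steps, written with the two intervals on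
which it does not vanish, so that it is visibly integrable. -/
noncomputable def stepDiff (a w : ℝ) : ℝ :=
  (Set.Ico a 0).indicator (fun _ => 1) w - (Set.Ico 0 a).indicator (fun _ => 1) w

lemma stepDiff_eq (a w : ℝ) :
    stepDiff a w =
      (Set.Ici a).indicator (fun _ => 1) w - (Set.Ici 0).indicator (fun _ => (1 : ℝ)) w := by
  simp only [stepDiff, Set.indicator_apply, Set.mem_Ico, Set.mem_Ici]
  grind

lemma integrable_stepDiff (a : ℝ) : Integrable (stepDiff a) := by
  unfold stepDiff
  refine Integrable.sub ?_ ?_ <;>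
    exact (integrable_indicator_iff measurableSet_Ico).2 (integrableOn_const (by simp))

lemma measurable_stepDiff : Measurable (fun p : ℝ × ℝ => stepDiff p.1 p.2) := by
  simp only [stepDiff_eq]
  refine Measurable.sub ?_ ?_
  · exact Measurable.ite (p := fun p : ℝ × ℝ => p.2 ∈ Set.Ici p.1)
      (measurableSet_le measurable_fst measurable_snd) measurable_const measurable_const
  · exact (measurable_const.indicator measurableSet_Ici).comp measurable_snd

lemma integral_mul_stepDiff (φ : ℝ → ℂ) (hφ : Continuous φ) (a : ℝ) :
    ∫ w, φ w * (stepDiff a w : ℂ) = -∫ w in (0 : ℝ)..a, φ w := by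
  have hi : ∀ b c : ℝ, IntegrableOn φ (Set.Ico b c) := fun b c =>
    (hφ.integrableOn_Icc (a := b) (b := c)).mono_set Set.Ico_subset_Icc_self
  have : ∀ w, φ w * (stepDiff a w : ℂ) =
      (Set.Ico a 0).indicator φ w - (Set.Ico 0 a).indicator φ w := by
    intro w
    simp only [stepDiff, Set.indicator_apply]
    split_ifs <;> simp
  simp_rw [this]
  rw [integral_sub ((integrable_indicator_iff measurableSet_Ico).2 (hi _ _))
    ((integrable_indicator_iff measurableSet_Ico).2 (hi _ _)),
    integral_indicator measurableSet_Ico, integral_indicator measurableSet_Ico,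
    integral_Ico_eq_integral_Ioc, integral_Ico_eq_integral_Ioc, intervalIntegral]
  ring

lemma integral_abs_stepDiff (a : ℝ) : ∫ w, |stepDiff a w| = |a| := by
  have : ∀ w, |stepDiff a w| =
      (Set.Ico a 0).indicator (fun _ => 1) w + (Set.Ico 0 a).indicator (fun _ => (1 : ℝ)) w := by
    intro w
    simp only [stepDiff, Set.indicator_apply, Set.mem_Ico]
    split_ifs <;> simp
    grind
  simp_rw [this]
  rw [integral_add ((integrable_indicator_iff measurableSet_Ico).2 (integrableOn_const (by simp)))
    ((integrable_indicator_iff measurableSet_Ico).2 (integrableOn_const (by simp))),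
    integral_indicator measurableSet_Ico, integral_indicator measurableSet_Ico]
  simp only [integral_const, MeasurableSet.univ, measureReal_restrict_apply, Set.univ_inter,
    Real.volume_real_Ico, smul_eq_mul, mul_one]
  rcases le_total a 0 with h | h
  · rw [abs_of_nonpos h, max_eq_left (by linarith), max_eq_right (by linarith)]; ring
  · rw [abs_of_nonneg h, max_eq_right (by linarith), max_eq_left (by linarith)]; ring

/-- A translate of a primitive of `q` differs from that primitive by the convolution of `q` with
a difference of steps. -/
lemma integrated_sub_integrated {q : ℝ → ℝ} (hq : Integrable q) (a x : ℝ) :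
    integrated q (x - a) - integrated q x = ∫ z, q z * stepDiff a (x - z) := by
  have : ∀ z, q z * stepDiff a (x - z) =
      (Set.Ioc x (x - a)).indicator q z - (Set.Ioc (x - a) x).indicator q z := by
    intro z
    simp only [stepDiff, Set.indicator_apply, Set.mem_Ico, Set.mem_Ioc]
    grind
  simp_rw [this]
  rw [integral_sub (hq.indicator measurableSet_Ioc) (hq.indicator measurableSet_Ioc),
    integral_indicator measurableSet_Ioc, integral_indicator measurableSet_Ioc]
  exact intervalIntegral.integral_Iic_sub_Iic hq.integrableOn hq.integrableOn

lemma norm_cexp_I_mul (t x : ℝ) : ‖Complex.exp (Complex.I * t * x)‖ = 1 := by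
  rw [show Complex.I * t * x = ((t * x : ℝ) : ℂ) * Complex.I by push_cast; ring]
  exact Complex.norm_exp_ofReal_mul_I _

lemma continuous_cexp_I_mul (t : ℝ) : Continuous fun x : ℝ => Complex.exp (Complex.I * t * x) := by
  fun_prop

lemma integrable_cexp_mul {q : ℝ → ℝ} (hq : Integrable q) (t : ℝ) :
    Integrable fun x : ℝ => Complex.exp (Complex.I * t * x) * (q x : ℂ) :=
  hq.ofReal.bdd_mul (c := 1) (continuous_cexp_I_mul t).aestronglyMeasurable
    (ae_of_all _ fun x => (norm_cexp_I_mul t x).le)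

/-- Multiplication by a character turns the convolution representing a translate difference into
the convolution of the two twisted factors. -/
lemma cexp_mul_integrated_sub {q : ℝ → ℝ} (hq : Integrable q) (a t : ℝ) :
    (fun x : ℝ => Complex.exp (Complex.I * t * x) *
      ((integrated q (x - a) - integrated q x : ℝ) : ℂ)) =
    convolution (fun z : ℝ => Complex.exp (Complex.I * t * z) * (q z : ℂ))
      (fun w : ℝ => Complex.exp (Complex.I * t * w) * (stepDiff a w : ℂ))
      (ContinuousLinearMap.mul ℝ ℂ) volume := by
  ext x
  rw [integrated_sub_integrated hq, convolution, ← integral_complex_ofReal, ← integral_const_mul]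
  congr 1 with z
  simp only [ContinuousLinearMap.mul_apply']
  rw [show Complex.I * t * x = Complex.I * t * z + Complex.I * t * ((x - z : ℝ) : ℂ) by
    push_cast; ring, Complex.exp_add]
  push_cast
  ring

lemma integrable_integrated_sub {q : ℝ → ℝ} (hq : Integrable q) (a : ℝ) :
    Integrable fun x => integrated q (x - a) - integrated q x := by
  have h := cexp_mul_integrated_sub hq a 0
  have h2 := (integrable_cexp_mul hq 0).integrable_convolution (ContinuousLinearMap.mul ℝ ℂ)
    (integrable_cexp_mul (integrable_stepDiff a) 0)
  rw [← h] at h2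
  simpa using h2.re

lemma fourierTr_integrated_sub {q : ℝ → ℝ} (hq : Integrable q) (a t : ℝ) :
    fourierTr (fun x => integrated q (x - a) - integrated q x) t =
      -(fourierTr q t * ∫ s in (0 : ℝ)..a, Complex.exp (Complex.I * t * s)) := by
  unfold fourierTr
  rw [cexp_mul_integrated_sub hq, integral_convolution _ (integrable_cexp_mul hq t)
    (integrable_cexp_mul (integrable_stepDiff a) t), ContinuousLinearMap.mul_apply',
    integral_mul_stepDiff _ (continuous_cexp_I_mul t)]
  ring

lemma integral_integrated_sub {q : ℝ → ℝ} (hq : Integrable q) (a : ℝ) :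
    ∫ x, (integrated q (x - a) - integrated q x) = -(a * ∫ x, q x) := by
  have h := fourierTr_integrated_sub hq a 0
  simp only [fourierTr, Complex.ofReal_zero, mul_zero, zero_mul, Complex.exp_zero, one_mul,
    intervalIntegral.integral_const, integral_complex_ofReal] at h
  have h' := congrArg Complex.re h
  simp only [sub_zero, Complex.real_smul, mul_one, Complex.neg_re, ← Complex.ofReal_mul,
    Complex.ofReal_re] at h'
  rw [h']; ring

lemma integrable_integrated_sub_sub {q : ℝ → ℝ} (hq : Integrable q) (a b : ℝ) :
    Integrable fun x => integrated q (x - a) - integrated q (x - b) := by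
  refine ((integrable_integrated_sub hq a).sub (integrable_integrated_sub hq b)).congr
    (ae_of_all _ fun x => ?_)
  simp

/-- Two translates of a distribution function are at `L¹` distance equal to the translation. -/
lemma integral_abs_integrated_sub {f : ℝ → ℝ} (hf : Integrable f) (h0 : ∀ x, 0 ≤ f x)
    (h1 : ∫ x, f x = 1) (a b : ℝ) :
    ∫ x, |integrated f (x - a) - integrated f (x - b)| = |a - b| := by
  have key : ∫ x, (integrated f (x - a) - integrated f (x - b)) = b - a := by
    have := integral_sub (integrable_integrated_sub hf a) (integrable_integrated_sub hf b)
    rw [integral_integrated_sub hf, integral_integrated_sub hf, h1] at this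
    simp only [sub_sub_sub_cancel_right] at this
    rw [this]; ring
  rcases le_total a b with h | h
  · have : ∀ x, |integrated f (x - a) - integrated f (x - b)| =
        integrated f (x - a) - integrated f (x - b) := fun x =>
      abs_of_nonneg (sub_nonneg.2 (monotone_integrated hf h0 (by linarith)))
    simp_rw [this]
    rw [key, abs_of_nonpos (by linarith)]; ring
  · have : ∀ x, |integrated f (x - a) - integrated f (x - b)| =
        -(integrated f (x - a) - integrated f (x - b)) := fun x =>
      abs_of_nonpos (sub_nonpos.2 (monotone_integrated hf h0 (by linarith)))
    simp_rw [this]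
    rw [integral_neg, key, abs_of_nonneg (by linarith)]; ring

/-- A finite first moment makes the primitive of a kernel of mass one integrably close to the unit
step. -/
lemma integrable_integrated_sub_step {q : ℝ → ℝ} (hq : Integrable q)
    (hm : Integrable fun y => y * q y) (h1 : ∫ y, q y = 1) :
    Integrable fun x => integrated q x - (Set.Ici 0).indicator (fun _ => (1 : ℝ)) x := by
  have hprod : Integrable (fun p : ℝ × ℝ => q p.2 * stepDiff p.2 p.1)
      (volume.prod volume) := by
    rw [integrable_prod_iff']
    · refine ⟨ae_of_all _ fun y => (integrable_stepDiff y).const_mul (q y), ?_⟩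
      simp only [norm_mul, Real.norm_eq_abs, integral_const_mul, integral_abs_stepDiff]
      refine hm.abs.congr (ae_of_all _ fun y => ?_)
      simp [abs_mul, mul_comm]
    · exact hq.aestronglyMeasurable.comp_snd.mul
        (measurable_stepDiff.comp measurable_swap).aestronglyMeasurable
  refine hprod.integral_prod_left.congr (ae_of_all _ fun x => ?_)
  have e : ∀ y, q y * stepDiff y x = (Set.Iic x).indicator q y -
      q y * (Set.Ici 0).indicator (fun _ => (1 : ℝ)) x := by
    intro y
    simp only [stepDiff_eq, Set.indicator_apply, Set.mem_Ici, Set.mem_Iic]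
    grind
  simp only [e]
  rw [integral_sub (hq.indicator measurableSet_Iic) (hq.mul_const _),
    integral_indicator measurableSet_Iic, integral_mul_const, h1, one_mul]
  rfl

lemma integrable_integrated_mul_one_sub {q : ℝ → ℝ} (hq : Integrable q)
    (hm : Integrable fun y => y * q y) (h1 : ∫ y, q y = 1) :
    Integrable fun x => integrated q x * (1 - integrated q x) := by
  have h := integrable_integrated_sub_step hq hm h1
  -- with `u = Q - 1[0 ≤ x]` one has `Q (1 - Q) = u (1 - Q - 1[0 ≤ x])`
  refine (h.bdd_mul (c := 2 + ∫ y, |q y|)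
    (f := fun x => 1 - integrated q x - (Set.Ici 0).indicator (fun _ => (1 : ℝ)) x)
    ?_ (ae_of_all _ fun x => ?_)).congr (ae_of_all _ fun x => ?_)
  · exact ((measurable_const.sub (continuous_integrated hq).measurable).sub
      (measurable_const.indicator measurableSet_Ici)).aestronglyMeasurable
  · have hb := abs_le.1 (abs_integrated_le hq x)
    rw [Real.norm_eq_abs, abs_le]
    simp only [Set.indicator_apply]
    split_ifs <;> constructor <;> linarith
  · simp only [Set.indicator_apply]
    split_ifs <;> ring

/-! ### The smoothed distribution function and its bias -/

/-- An integrable function of total mass one with an absolute first moment. It may take negative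
values. -/
structure IsKernel (q : ℝ → ℝ) : Prop where
  int : Integrable q
  mass : ∫ x, q x = 1
  moment : Integrable fun x => x * q x

/-- A nonnegative kernel, that is, a probability density with a first moment. -/
structure IsDensity (f : ℝ → ℝ) : Prop extends IsKernel f where
  nonneg : ∀ x, 0 ≤ f x

/-- The mean `x ↦ ∫ k(y) F(x - h y) dy` of the kernel estimator with bandwidth `h`, where `F` has
density `f`. For `h = 0` it is `F`, when `k` has mass one. -/
noncomputable def smoothedCDF (f k : ℝ → ℝ) (h x : ℝ) : ℝ :=
  ∫ y, k y * integrated f (x - h * y)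

/-- The bias of the kernel estimator with bandwidth `h` at the point `x`. -/
noncomputable def cdfBias (f k : ℝ → ℝ) (h x : ℝ) : ℝ := smoothedCDF f k h x - integrated f x

/-- The integrated squared bias as a real number. -/
noncomputable def sqBias (f k : ℝ → ℝ) (h : ℝ) : ℝ := ∫ x, cdfBias f k h x ^ 2

/-- The derivative of `ψ` at `F` in the direction of the bias. -/
noncomputable def crossBias (f k : ℝ → ℝ) (h : ℝ) : ℝ :=
  ∫ x, cdfBias f k h x * (1 - 2 * integrated f x)

/-- The squared `L²` distance between `F` and its translate by `a`. -/
noncomputable def shiftEnergy (f : ℝ → ℝ) (a : ℝ) : ℝ :=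
  ∫ x, (integrated f (x - a) - integrated f x) ^ 2

section

variable {f k : ℝ → ℝ}

lemma IsDensity.integrated_le_one (hf : IsDensity f) (x : ℝ) : integrated f x ≤ 1 :=
  (integrated_le_integral hf.int hf.nonneg x).trans_eq hf.mass

lemma IsDensity.integrated_nonneg (hf : IsDensity f) (x : ℝ) : 0 ≤ integrated f x :=
  _root_.integrated_nonneg hf.nonneg x

lemma IsDensity.abs_integrated_le_one (hf : IsDensity f) (x : ℝ) : |integrated f x| ≤ 1 :=
  abs_le.2 ⟨by linarith [hf.integrated_nonneg x], hf.integrated_le_one x⟩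

lemma IsDensity.abs_integrated_sub_le_one (hf : IsDensity f) (x y : ℝ) :
    |integrated f x - integrated f y| ≤ 1 :=
  abs_le.2 ⟨by linarith [hf.integrated_nonneg x, hf.integrated_le_one y],
    by linarith [hf.integrated_nonneg y, hf.integrated_le_one x]⟩

lemma integrable_mul_integrated (hf : IsDensity f) (hk : IsKernel k) (h x : ℝ) :
    Integrable fun y => k y * integrated f (x - h * y) :=
  hk.int.mul_bdd (c := 1)
    ((continuous_integrated hf.int).comp (by fun_prop)).aestronglyMeasurable
    (ae_of_all _ fun _ => hf.abs_integrated_le_one _)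

lemma abs_smoothedCDF_le (hf : IsDensity f) (hk : IsKernel k) (h x : ℝ) :
    |smoothedCDF f k h x| ≤ ∫ y, |k y| := by
  refine abs_integral_le_integral_abs.trans
    (integral_mono (integrable_mul_integrated hf hk h x).abs hk.int.abs fun y => ?_)
  simp only [abs_mul]
  exact mul_le_of_le_one_right (abs_nonneg _) (hf.abs_integrated_le_one _)

lemma continuous_smoothedCDF (hf : IsDensity f) (hk : IsKernel k) (h : ℝ) :
    Continuous (smoothedCDF f k h) := by
  refine continuous_of_dominated (bound := fun y => |k y|)
    (fun x => (integrable_mul_integrated hf hk h x).aestronglyMeasurable)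
    (fun x => ae_of_all _ fun y => ?_) hk.int.abs (ae_of_all _ fun y => ?_)
  · rw [norm_mul]
    exact mul_le_of_le_one_right (abs_nonneg _) (hf.abs_integrated_le_one _)
  · exact continuous_const.mul ((continuous_integrated hf.int).comp (by fun_prop))

lemma continuous_cdfBias (hf : IsDensity f) (hk : IsKernel k) (h : ℝ) :
    Continuous (cdfBias f k h) :=
  (continuous_smoothedCDF hf hk h).sub (continuous_integrated hf.int)

lemma abs_cdfBias_le (hf : IsDensity f) (hk : IsKernel k) (h x : ℝ) :
    |cdfBias f k h x| ≤ (∫ y, |k y|) + 1 :=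
  (abs_sub _ _).trans (add_le_add (abs_smoothedCDF_le hf hk h x) (hf.abs_integrated_le_one x))

lemma smoothedCDF_zero (hk : IsKernel k) (x : ℝ) : smoothedCDF f k 0 x = integrated f x := by
  simp [smoothedCDF, integral_mul_const, hk.mass]

lemma smoothedCDF_sub_smoothedCDF (hf : IsDensity f) (hk : IsKernel k) (h h' x : ℝ) :
    smoothedCDF f k h x - smoothedCDF f k h' x =
      ∫ y, k y * (integrated f (x - h * y) - integrated f (x - h' * y)) := by
  simp only [mul_sub]
  rw [integral_sub (integrable_mul_integrated hf hk h x) (integrable_mul_integrated hf hk h' x)]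
  rfl

lemma cdfBias_eq (hf : IsDensity f) (hk : IsKernel k) (h x : ℝ) :
    cdfBias f k h x = ∫ y, k y * (integrated f (x - h * y) - integrated f x) := by
  have := smoothedCDF_sub_smoothedCDF hf hk h 0 x
  simp only [smoothedCDF_zero hk, zero_mul, sub_zero] at this
  exact this

lemma integrable_prod_mul_integrated_sub (hf : IsDensity f) (hk : IsKernel k) (h h' : ℝ) :
    Integrable (fun p : ℝ × ℝ => k p.2 * (integrated f (p.1 - h * p.2) -
      integrated f (p.1 - h' * p.2))) (volume.prod volume) := by
  rw [integrable_prod_iff']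
  · refine ⟨ae_of_all _ fun y =>
      (integrable_integrated_sub_sub hf.int (h * y) (h' * y)).const_mul (k y), ?_⟩
    simp only [norm_mul, Real.norm_eq_abs, integral_const_mul,
      integral_abs_integrated_sub hf.int hf.nonneg hf.mass]
    refine (hk.moment.abs.mul_const |h - h'|).congr (ae_of_all _ fun y => ?_)
    simp only [← abs_mul]
    congr 1; ring
  · refine hk.int.aestronglyMeasurable.comp_snd.mul (Continuous.aestronglyMeasurable ?_)
    have := continuous_integrated hf.int
    exact (this.comp (by fun_prop)).sub (this.comp (by fun_prop))

lemma integrable_smoothedCDF_sub (hf : IsDensity f) (hk : IsKernel k) (h h' : ℝ) :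
    Integrable fun x => smoothedCDF f k h x - smoothedCDF f k h' x := by
  simp only [smoothedCDF_sub_smoothedCDF hf hk]
  exact (integrable_prod_mul_integrated_sub hf hk h h').integral_prod_left

lemma integrable_cdfBias (hf : IsDensity f) (hk : IsKernel k) (h : ℝ) :
    Integrable (cdfBias f k h) := by
  have := integrable_smoothedCDF_sub hf hk h 0
  simp only [smoothedCDF_zero hk] at this
  exact this

/-- The mean of the estimator is a Lipschitz function of the bandwidth, for the `L¹` distance. -/
lemma integral_abs_smoothedCDF_sub_le (hf : IsDensity f) (hk : IsKernel k) (h h' : ℝ) :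
    ∫ x, |smoothedCDF f k h x - smoothedCDF f k h' x| ≤ (∫ y, |y * k y|) * |h - h'| := by
  have hp := integrable_prod_mul_integrated_sub hf hk h h'
  calc ∫ x, |smoothedCDF f k h x - smoothedCDF f k h' x|
      ≤ ∫ x, ∫ y, |k y * (integrated f (x - h * y) - integrated f (x - h' * y))| := by
        refine integral_mono (integrable_smoothedCDF_sub hf hk h h').abs
          hp.integral_norm_prod_left fun x => ?_
        simp only [smoothedCDF_sub_smoothedCDF hf hk]
        exact abs_integral_le_integral_abs
    _ = ∫ y, ∫ x, |k y * (integrated f (x - h * y) - integrated f (x - h' * y))| :=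
        integral_integral_swap hp.abs
    _ = (∫ y, |y * k y|) * |h - h'| := by
        rw [← integral_mul_const]
        congr 1 with y
        simp only [abs_mul, integral_const_mul,
          integral_abs_integrated_sub hf.int hf.nonneg hf.mass]
        rw [← sub_mul, abs_mul]; ring

lemma integrable_cdfBias_sq (hf : IsDensity f) (hk : IsKernel k) (h : ℝ) :
    Integrable fun x => cdfBias f k h x ^ 2 := by
  simp only [sq]
  exact (integrable_cdfBias hf hk h).mul_bdd (c := (∫ y, |k y|) + 1)
    (continuous_cdfBias hf hk h).aestronglyMeasurable
    (ae_of_all _ fun x => abs_cdfBias_le hf hk h x)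

lemma abs_one_sub_two_mul_integrated_le (hf : IsDensity f) (x : ℝ) :
    |1 - 2 * integrated f x| ≤ 1 :=
  abs_le.2 ⟨by linarith [hf.integrated_le_one x], by linarith [hf.integrated_nonneg x]⟩

lemma continuous_one_sub_two_mul_integrated (hf : IsDensity f) :
    Continuous fun x => 1 - 2 * integrated f x := by
  have := continuous_integrated hf.int
  fun_prop

lemma integrable_cdfBias_mul (hf : IsDensity f) (hk : IsKernel k) (h : ℝ) :
    Integrable fun x => cdfBias f k h x * (1 - 2 * integrated f x) :=
  (integrable_cdfBias hf hk h).mul_bdd (c := 1)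
    (continuous_one_sub_two_mul_integrated hf).aestronglyMeasurable
    (ae_of_all _ fun x => abs_one_sub_two_mul_integrated_le hf x)

lemma continuous_of_abs_sub_le {g : ℝ → ℝ} {C : ℝ} (hg : ∀ x y, |g x - g y| ≤ C * |x - y|) :
    Continuous g := by
  have hC : 0 ≤ C := by simpa using (abs_nonneg _).trans (hg 1 0)
  exact (LipschitzWith.of_dist_le_mul (K := ⟨C, hC⟩) fun x y => hg x y).continuous

lemma continuous_crossBias (hf : IsDensity f) (hk : IsKernel k) :
    Continuous (crossBias f k) := by
  refine continuous_of_abs_sub_le (C := ∫ y, |y * k y|) fun h h' => ?_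
  rw [crossBias, crossBias, ← integral_sub (integrable_cdfBias_mul hf hk h)
    (integrable_cdfBias_mul hf hk h')]
  refine abs_integral_le_integral_abs.trans
    (le_trans (integral_mono ?_ (integrable_smoothedCDF_sub hf hk h h').abs fun x => ?_)
      (integral_abs_smoothedCDF_sub_le hf hk h h'))
  · exact ((integrable_cdfBias_mul hf hk h).sub (integrable_cdfBias_mul hf hk h')).abs
  · have : cdfBias f k h x * (1 - 2 * integrated f x) - cdfBias f k h' x *
        (1 - 2 * integrated f x) = (smoothedCDF f k h x - smoothedCDF f k h' x) *
          (1 - 2 * integrated f x) := by simp only [cdfBias]; ring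
    simp only [this, abs_mul]
    exact mul_le_of_le_one_right (abs_nonneg _) (abs_one_sub_two_mul_integrated_le hf x)

lemma continuous_sqBias (hf : IsDensity f) (hk : IsKernel k) :
    Continuous (sqBias f k) := by
  set A := (∫ y, |k y|) + 1 with hA
  refine continuous_of_abs_sub_le (C := (2 * A) * ∫ y, |y * k y|) fun h h' => ?_
  rw [sqBias, sqBias, ← integral_sub (integrable_cdfBias_sq hf hk h)
    (integrable_cdfBias_sq hf hk h'), mul_assoc]
  refine abs_integral_le_integral_abs.trans
    (le_trans (integral_mono ?_
      ((integrable_smoothedCDF_sub hf hk h h').abs.const_mul (2 * A)) fun x => ?_) ?_)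
  · exact ((integrable_cdfBias_sq hf hk h).sub (integrable_cdfBias_sq hf hk h')).abs
  · have : cdfBias f k h x ^ 2 - cdfBias f k h' x ^ 2 =
        (cdfBias f k h x + cdfBias f k h' x) *
          (smoothedCDF f k h x - smoothedCDF f k h' x) := by simp only [cdfBias]; ring
    simp only [this, abs_mul]
    refine mul_le_mul_of_nonneg_right ((abs_add_le _ _).trans ?_) (abs_nonneg _)
    linarith [abs_cdfBias_le hf hk h x, abs_cdfBias_le hf hk h' x]
  · rw [integral_const_mul]
    refine mul_le_mul_of_nonneg_left (integral_abs_smoothedCDF_sub_le hf hk h h') ?_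
    have : 0 ≤ ∫ y, |k y| := integral_nonneg fun _ => abs_nonneg _
    linarith

lemma sqBias_nonneg (f k : ℝ → ℝ) (h : ℝ) : 0 ≤ sqBias f k h :=
  integral_nonneg fun _ => sq_nonneg _

lemma sqBias_eq_zero_iff (hf : IsDensity f) (hk : IsKernel k) (h : ℝ) :
    sqBias f k h = 0 ↔ ∀ x, cdfBias f k h x = 0 := by
  rw [sqBias, integral_eq_zero_iff_of_nonneg (fun _ => sq_nonneg _)
    (integrable_cdfBias_sq hf hk h)]
  constructor
  · intro hae x
    have := Continuous.ae_eq_iff_eq volume ((continuous_cdfBias hf hk h).pow 2)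
      (continuous_const (y := (0 : ℝ))) |>.1 hae
    exact pow_eq_zero_iff (two_ne_zero) |>.1 (congrFun this x)
  · intro h0
    exact ae_of_all _ fun x => by simp [h0]

lemma crossBias_eq_zero (hf : IsDensity f) (hk : IsKernel k) {h : ℝ} (h0 : sqBias f k h = 0) :
    crossBias f k h = 0 := by
  simp [crossBias, (sqBias_eq_zero_iff hf hk h).1 h0]

/-! ### The bias is negligible for small bandwidths -/

lemma integrable_integrated_sub_sq (hf : IsDensity f) (a : ℝ) :
    Integrable fun x => (integrated f (x - a) - integrated f x) ^ 2 := by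
  simp only [sq]
  have hc := continuous_integrated hf.int
  exact (integrable_integrated_sub hf.int a).mul_bdd (c := 1)
    ((hc.comp (by fun_prop)).sub hc).aestronglyMeasurable
    (ae_of_all _ fun x => hf.abs_integrated_sub_le_one _ _)

lemma shiftEnergy_nonneg (f : ℝ → ℝ) (a : ℝ) : 0 ≤ shiftEnergy f a :=
  integral_nonneg fun _ => sq_nonneg _

lemma shiftEnergy_le_of_abs_le (hf : IsDensity f) {a ε : ℝ}
    (h : ∀ x, |integrated f (x - a) - integrated f x| ≤ ε) : shiftEnergy f a ≤ ε * |a| := by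
  have h1 := integral_abs_integrated_sub hf.int hf.nonneg hf.mass a 0
  simp only [sub_zero] at h1
  rw [← h1, ← integral_const_mul]
  refine integral_mono (integrable_integrated_sub_sq hf a)
    ((integrable_integrated_sub hf.int a).abs.const_mul ε) fun x => ?_
  simp only
  rw [← sq_abs, sq]
  exact mul_le_mul_of_nonneg_right (h x) (abs_nonneg _)

/-- Translation invariance of `ψ` makes the first variation of `ψ` along a translation equal to
the quadratic remainder. -/
lemma integral_integrated_sub_mul (hf : IsDensity f) (a : ℝ) :
    ∫ x, (integrated f (x - a) - integrated f x) * (1 - 2 * integrated f x) =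
      shiftEnergy f a := by
  have hpsi := integrable_integrated_mul_one_sub hf.int hf.moment hf.mass
  have h1 : ∫ x, integrated f (x - a) * (1 - integrated f (x - a)) =
      ∫ x, integrated f x * (1 - integrated f x) :=
    integral_sub_right_eq_self (fun x => integrated f x * (1 - integrated f x)) a
  have e : ∀ x, (integrated f (x - a) - integrated f x) * (1 - 2 * integrated f x) =
      (integrated f (x - a) * (1 - integrated f (x - a)) -
        integrated f x * (1 - integrated f x)) +
      (integrated f (x - a) - integrated f x) ^ 2 := fun x => by ring
  have hpsi' : Integrable fun x => integrated f (x - a) * (1 - integrated f (x - a)) :=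
    hpsi.comp_sub_right a
  have hd : Integrable fun x => integrated f (x - a) * (1 - integrated f (x - a)) -
      integrated f x * (1 - integrated f x) := hpsi'.sub hpsi
  simp only [e]
  rw [integral_add hd (integrable_integrated_sub_sq hf a),
    integral_sub hpsi' hpsi, h1, sub_self, zero_add]
  rfl

lemma uniformContinuous_integrated (hf : IsDensity f) : UniformContinuous (integrated f) := by
  rw [Metric.uniformContinuous_iff]
  intro ε hε
  have hfin : ∫⁻ x, ENNReal.ofReal (f x) ≠ ∞ := by
    rw [← ofReal_integral_eq_lintegral_ofReal hf.int (ae_of_all _ hf.nonneg)]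
    exact ENNReal.ofReal_ne_top
  obtain ⟨δ, hδ, H⟩ := exists_pos_setLIntegral_lt_of_measure_lt hfin
    (ENNReal.ofReal_pos.2 hε).ne'
  obtain ⟨d, hd, hdδ⟩ : ∃ d : ℝ, 0 < d ∧ ENNReal.ofReal d ≤ δ := by
    rcases eq_or_ne δ ∞ with rfl | hδ'
    · exact ⟨1, one_pos, le_top⟩
    · exact ⟨δ.toReal, ENNReal.toReal_pos hδ.ne' hδ', by rw [ENNReal.ofReal_toReal hδ']⟩
  have key : ∀ a b : ℝ, a ≤ b → b - a < d → integrated f b - integrated f a < ε := by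
    intro a b hab hlt
    have h1 : integrated f b - integrated f a = ∫ y in Set.Ioc a b, f y := by
      rw [integrated, integrated, intervalIntegral.integral_Iic_sub_Iic hf.int.integrableOn
        hf.int.integrableOn, intervalIntegral.integral_of_le hab]
    have h2 := H (Set.Ioc a b) (by
      rw [Real.volume_Ioc]
      exact ((ENNReal.ofReal_lt_ofReal_iff hd).2 hlt).trans_le hdδ)
    rw [← ofReal_integral_eq_lintegral_ofReal hf.int.integrableOn (ae_of_all _ hf.nonneg),
      ENNReal.ofReal_lt_ofReal_iff hε] at h2
    rwa [h1]
  refine ⟨d, hd, fun {a b} hab => ?_⟩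
  rw [Real.dist_eq] at hab ⊢
  have hm := monotone_integrated hf.int hf.nonneg
  rcases le_total a b with h | h
  · rw [abs_sub_comm, abs_of_nonneg (sub_nonneg.2 (hm h))]
    exact key a b h (by rw [abs_sub_comm] at hab; exact (le_abs_self _).trans_lt hab)
  · rw [abs_of_nonneg (sub_nonneg.2 (hm h))]
    exact key b a h ((le_abs_self _).trans_lt hab)

lemma shiftEnergy_le (hf : IsDensity f) (a : ℝ) : shiftEnergy f a ≤ |a| := by
  simpa using shiftEnergy_le_of_abs_le hf (fun x => hf.abs_integrated_sub_le_one (x - a) x)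

lemma tendsto_inv_mul_shiftEnergy (hf : IsDensity f) (y : ℝ) :
    Tendsto (fun h : ℝ => h⁻¹ * shiftEnergy f (h * y)) (𝓝[>] 0) (𝓝 0) := by
  rw [Metric.tendsto_nhdsWithin_nhds]
  intro ε hε
  have hε' : 0 < ε / (2 * (|y| + 1)) := by positivity
  obtain ⟨δ, hδ, H⟩ := Metric.uniformContinuous_iff.1 (uniformContinuous_integrated hf) _ hε'
  refine ⟨δ / (|y| + 1), by positivity, fun {h} hh hlt => ?_⟩
  have hh : 0 < h := hh
  rw [Real.dist_eq, sub_zero, abs_of_pos hh, lt_div_iff₀ (by positivity)] at hlt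
  have hsm : |h * y| < δ := by
    rw [abs_mul, abs_of_pos hh]
    nlinarith [abs_nonneg y]
  have hb := shiftEnergy_le_of_abs_le hf (a := h * y) (ε := ε / (2 * (|y| + 1))) fun x => by
    refine (H (a := x - h * y) (b := x) ?_).le
    rw [Real.dist_eq]
    simpa using hsm
  rw [Real.dist_eq, sub_zero, abs_of_nonneg (mul_nonneg (inv_nonneg.2 hh.le)
    (shiftEnergy_nonneg _ _)), inv_mul_lt_iff₀ hh]
  refine hb.trans_lt ?_
  rw [abs_mul, abs_of_pos hh, div_mul_eq_mul_div, div_lt_iff₀ (by positivity)]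
  have : 0 < ε * h := by positivity
  nlinarith [abs_nonneg y, mul_nonneg this.le (abs_nonneg y)]

lemma integrable_prod_mul_integrated_sub_sq (hf : IsDensity f) (hk : IsKernel k) (h : ℝ) :
    Integrable (fun p : ℝ × ℝ => |k p.2| * (integrated f (p.1 - h * p.2) -
      integrated f p.1) ^ 2) (volume.prod volume) := by
  have hc := continuous_integrated hf.int
  have h1 := integrable_prod_mul_integrated_sub hf hk h 0
  simp only [zero_mul, sub_zero] at h1
  refine (h1.abs.mul_bdd (c := 1) (g := fun p : ℝ × ℝ =>
      |integrated f (p.1 - h * p.2) - integrated f p.1|) ?_ ?_).congr ?_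
  · exact (((hc.comp (by fun_prop)).sub (hc.comp (by fun_prop))).abs).aestronglyMeasurable
  · exact ae_of_all _ fun p => by
      simpa using hf.abs_integrated_sub_le_one (p.1 - h * p.2) p.1
  · refine ae_of_all _ fun p => ?_
    simp only [abs_mul]
    rw [mul_assoc, ← sq, sq_abs]

lemma integrable_mul_shiftEnergy (hf : IsDensity f) (hk : IsKernel k) (h : ℝ) :
    Integrable fun y => |k y| * shiftEnergy f (h * y) := by
  have := (integrable_prod_mul_integrated_sub_sq hf hk h).integral_prod_right
  simp only [integral_const_mul] at this
  exact this

lemma crossBias_le (hf : IsDensity f) (hk : IsKernel k) (h : ℝ) :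
    crossBias f k h ≤ ∫ y, |k y| * shiftEnergy f (h * y) := by
  have h1 := integrable_prod_mul_integrated_sub hf hk h 0
  simp only [zero_mul, sub_zero] at h1
  have h2 : Integrable (fun p : ℝ × ℝ => k p.2 * (integrated f (p.1 - h * p.2) -
      integrated f p.1) * (1 - 2 * integrated f p.1)) (volume.prod volume) :=
    h1.mul_bdd (c := 1)
      ((continuous_one_sub_two_mul_integrated hf).comp continuous_fst).aestronglyMeasurable
      (ae_of_all _ fun p => abs_one_sub_two_mul_integrated_le hf p.1)
  have e : crossBias f k h = ∫ y, k y * shiftEnergy f (h * y) := by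
    simp only [crossBias, cdfBias_eq hf hk, ← integral_mul_const]
    rw [integral_integral_swap h2]
    simp only [mul_assoc, integral_const_mul, integral_integrated_sub_mul hf]
  rw [e]
  refine (le_abs_self _).trans (abs_integral_le_integral_abs.trans_eq ?_)
  congr 1 with y
  rw [abs_mul, abs_of_nonneg (shiftEnergy_nonneg _ _)]

lemma IsKernel.one_le_integral_abs (hk : IsKernel k) : 1 ≤ ∫ y, |k y| := by
  have := abs_integral_le_integral_abs (f := k) (μ := volume)
  rwa [hk.mass, abs_one] at this

lemma sqBias_le (hf : IsDensity f) (hk : IsKernel k) (h : ℝ) :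
    sqBias f k h ≤ (∫ y, |k y|) * ∫ y, |k y| * shiftEnergy f (h * y) := by
  set A := ∫ y, |k y| with hA
  have hA1 : 1 ≤ A := hk.one_le_integral_abs
  have h2 := integrable_prod_mul_integrated_sub_sq hf hk h
  have hc := continuous_integrated hf.int
  -- the Cauchy-Schwarz inequality for the measure `|k(y)| dy`
  have cs : ∀ x, cdfBias f k h x ^ 2 ≤
      A * ∫ y, |k y| * (integrated f (x - h * y) - integrated f x) ^ 2 := by
    intro x
    set u : ℝ → ℝ := fun y => |integrated f (x - h * y) - integrated f x| with hu
    have hum : AEStronglyMeasurable u :=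
      ((hc.comp (by fun_prop)).sub continuous_const).abs.aestronglyMeasurable
    have i1 : Integrable fun y => |k y| * u y :=
      hk.int.abs.mul_bdd (c := 1) hum
        (ae_of_all _ fun y => by simpa [hu] using hf.abs_integrated_sub_le_one (x - h * y) x)
    have i2 : Integrable fun y => |k y| * u y ^ 2 := by
      refine hk.int.abs.mul_bdd (c := 1) (hum.pow 2) (ae_of_all _ fun y => ?_)
      simpa [hu] using hf.abs_integrated_sub_le_one (x - h * y) x
    have hD : |cdfBias f k h x| ≤ ∫ y, |k y| * u y := by
      rw [cdfBias_eq hf hk]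
      refine abs_integral_le_integral_abs.trans_eq ?_
      congr 1 with y
      rw [abs_mul]
    set D := ∫ y, |k y| * u y with hDdef
    have hpos : 0 ≤ ∫ y, |k y| * (A * u y - D) ^ 2 :=
      integral_nonneg fun y => mul_nonneg (abs_nonneg _) (sq_nonneg _)
    have e : ∀ y, |k y| * (A * u y - D) ^ 2 =
        A ^ 2 * (|k y| * u y ^ 2) - (2 * A * D) * (|k y| * u y) + D ^ 2 * |k y| :=
      fun y => by ring
    simp only [e] at hpos
    have i3 : Integrable fun y => A ^ 2 * (|k y| * u y ^ 2) - 2 * A * D * (|k y| * u y) :=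
      (i2.const_mul _).sub (i1.const_mul _)
    rw [integral_add i3 (hk.int.abs.const_mul _),
      integral_sub (i2.const_mul _) (i1.const_mul _), integral_const_mul, integral_const_mul,
      integral_const_mul, ← hA, ← hDdef] at hpos
    have : D ^ 2 ≤ A * ∫ y, |k y| * u y ^ 2 := by
      have h3 : 0 ≤ A * (A * (∫ y, |k y| * u y ^ 2) - D ^ 2) := by nlinarith
      linarith [nonneg_of_mul_nonneg_right h3 (by linarith)]
    simp only [hu, sq_abs] at this
    refine le_trans ?_ this
    rw [← sq_abs]
    exact pow_le_pow_left₀ (abs_nonneg _) hD 2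
  calc sqBias f k h
      ≤ ∫ x, A * ∫ y, |k y| * (integrated f (x - h * y) - integrated f x) ^ 2 :=
        integral_mono (integrable_cdfBias_sq hf hk h) (h2.integral_prod_left.const_mul A) cs
    _ = A * ∫ y, |k y| * shiftEnergy f (h * y) := by
        rw [integral_const_mul, integral_integral_swap h2]
        simp only [integral_const_mul, shiftEnergy]

lemma tendsto_inv_mul_integral_shiftEnergy (hf : IsDensity f) (hk : IsKernel k) :
    Tendsto (fun h : ℝ => h⁻¹ * ∫ y, |k y| * shiftEnergy f (h * y)) (𝓝[>] 0) (𝓝 0) := by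
  simp only [← integral_const_mul]
  have hz : (0 : ℝ) = ∫ _ : ℝ, (0 : ℝ) := by simp
  conv => rhs; rw [hz]
  refine tendsto_integral_filter_of_dominated_convergence (fun y => |y * k y|)
    (.of_forall fun h => ((integrable_mul_shiftEnergy hf hk h).const_mul _).aestronglyMeasurable)
    ?_ hk.moment.abs (ae_of_all _ fun y => ?_)
  · filter_upwards [self_mem_nhdsWithin] with h (hh : 0 < h)
    refine ae_of_all _ fun y => ?_
    rw [Real.norm_eq_abs, abs_of_nonneg (mul_nonneg (inv_nonneg.2 hh.le)
      (mul_nonneg (abs_nonneg _) (shiftEnergy_nonneg _ _))), inv_mul_le_iff₀ hh]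
    calc |k y| * shiftEnergy f (h * y) ≤ |k y| * |h * y| :=
          mul_le_mul_of_nonneg_left (shiftEnergy_le hf _) (abs_nonneg _)
      _ = h * |y * k y| := by rw [abs_mul, abs_mul, abs_of_pos hh]; ring
  · have := (tendsto_inv_mul_shiftEnergy hf y).const_mul |k y|
    rw [mul_zero] at this
    refine this.congr fun h => ?_
    ring

/-! ### The integrated squared bias explodes for large bandwidths -/

lemma lintegral_ofReal_sq_eq_top {g : ℝ → ℝ} {l : Filter ℝ} {c : ℝ} (hgm : Measurable g)
    (hc : c ≠ 0) (hg : Tendsto g l (𝓝 c)) (hl : ∀ s ∈ l, volume s = ∞) :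
    ∫⁻ x, ENNReal.ofReal (g x ^ 2) = ∞ := by
  have hc2 : 0 < c ^ 2 := by positivity
  have hev : ∀ᶠ x in l, c ^ 2 / 2 < g x ^ 2 :=
    (hg.pow 2).eventually_const_lt (half_lt_self hc2)
  have h2 := mul_meas_ge_le_lintegral (μ := volume) (hgm.pow_const 2).ennreal_ofReal
    (ENNReal.ofReal (c ^ 2 / 2))
  rw [hl _ (hev.mono fun x hx => ENNReal.ofReal_le_ofReal hx.le), ENNReal.mul_top
    (ENNReal.ofReal_pos.2 (half_pos hc2)).ne'] at h2
  exact top_le_iff.1 h2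

lemma lintegral_ofReal_const_sub_integrated_sq (hf : IsDensity f) (c : ℝ) :
    ∫⁻ x, ENNReal.ofReal ((c - integrated f x) ^ 2) = ∞ := by
  have hm : Measurable fun x => c - integrated f x :=
    measurable_const.sub (continuous_integrated hf.int).measurable
  by_cases hc : c = 0
  · refine lintegral_ofReal_sq_eq_top (l := atTop) (c := c - 1) hm (by simp [hc]) ?_ fun s hs => ?_
    · have := tendsto_integrated_atTop hf.int
      rw [hf.mass] at this
      exact this.const_sub c
    · obtain ⟨a, ha⟩ := mem_atTop_sets.1 hs
      exact top_le_iff.1 ((Real.volume_Ici (a := a)).symm.le.trans (measure_mono ha))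
  · refine lintegral_ofReal_sq_eq_top (l := atBot) (c := c - 0) hm (by simpa) ?_ fun s hs => ?_
    · exact tendsto_integrated_atBot.const_sub c
    · obtain ⟨a, ha⟩ := mem_atBot_sets.1 hs
      exact top_le_iff.1 ((Real.volume_Iic (a := a)).symm.le.trans (measure_mono ha))

lemma tendsto_smoothedCDF_atTop (hf : IsDensity f) (hk : IsKernel k) (x : ℝ) :
    Tendsto (fun h => smoothedCDF f k h x) atTop (𝓝 (integrated k 0)) := by
  rw [integrated, integral_Iic_eq_integral_Iio, ← integral_indicator measurableSet_Iio]
  refine tendsto_integral_filter_of_dominated_convergence (fun y => |k y|)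
    (.of_forall fun h => (integrable_mul_integrated hf hk h x).aestronglyMeasurable)
    (.of_forall fun h => ae_of_all _ fun y => ?_) hk.int.abs ?_
  · rw [norm_mul]
    exact mul_le_of_le_one_right (abs_nonneg _) (hf.abs_integrated_le_one _)
  · filter_upwards [compl_mem_ae_iff.2 (measure_singleton (0 : ℝ))] with y hy
    have hy : y ≠ 0 := hy
    rcases lt_or_gt_of_ne hy with hy | hy
    · have h1 : Tendsto (fun h : ℝ => x - h * y) atTop atTop := by
        have := tendsto_atTop_add_const_left atTop x
          (tendsto_id.atTop_mul_const (neg_pos.2 hy))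
        refine this.congr fun h => ?_
        simp only [id]; ring
      have h2 := ((tendsto_integrated_atTop hf.int).comp h1).const_mul (k y)
      rw [hf.mass, mul_one] at h2
      rw [Set.indicator_of_mem (Set.mem_Iio.2 hy)]
      exact h2
    · have h1 : Tendsto (fun h : ℝ => x - h * y) atTop atBot := by
        have := tendsto_atBot_add_const_left atTop x
          (tendsto_neg_atTop_atBot.comp (tendsto_id.atTop_mul_const hy))
        refine this.congr fun h => ?_
        simp only [id, Function.comp]; ring
      have h2 := ((tendsto_integrated_atBot (q := f)).comp h1).const_mul (k y)
      rw [mul_zero] at h2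
      rw [Set.indicator_of_notMem (by simpa using hy.le)]
      exact h2

lemma lintegral_ofReal_cdfBias_sq (hf : IsDensity f) (hk : IsKernel k) (h : ℝ) :
    ∫⁻ x, ENNReal.ofReal (cdfBias f k h x ^ 2) = ENNReal.ofReal (sqBias f k h) :=
  (ofReal_integral_eq_lintegral_ofReal (integrable_cdfBias_sq hf hk h)
    (ae_of_all _ fun _ => sq_nonneg _)).symm

/-- For large bandwidths the mean of the estimator approaches the constant `K(0)` pointwise, and
no constant is at finite `L²` distance from a distribution function. -/
lemma tendsto_sqBias_atTop (hf : IsDensity f) (hk : IsKernel k) :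
    Tendsto (sqBias f k) atTop atTop := by
  rw [← ENNReal.tendsto_ofReal_nhds_top]
  have hF := lintegral_liminf_le (μ := volume) (u := (atTop : Filter ℝ))
    (f := fun h x => ENNReal.ofReal (cdfBias f k h x ^ 2))
    fun h => ((continuous_cdfBias hf hk h).measurable.pow_const 2).ennreal_ofReal
  have hlim : ∀ x, liminf (fun h => ENNReal.ofReal (cdfBias f k h x ^ 2)) atTop =
      ENNReal.ofReal ((integrated k 0 - integrated f x) ^ 2) := fun x =>
    (ENNReal.tendsto_ofReal
      (((tendsto_smoothedCDF_atTop hf hk x).sub_const (integrated f x)).pow 2)).liminf_eq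
  simp only [hlim, lintegral_ofReal_const_sub_integrated_sq hf,
    lintegral_ofReal_cdfBias_sq hf hk] at hF
  exact tendsto_of_le_liminf_of_limsup_le hF le_top

end

/-! ### Vanishing of the bias in the frequency domain -/

section

variable {f k : ℝ → ℝ}

lemma fourierTr_zero (q : ℝ → ℝ) : fourierTr q 0 = ((∫ x, q x : ℝ) : ℂ) := by
  simp [fourierTr, integral_complex_ofReal]

lemma fourierTr_neg (q : ℝ → ℝ) (t : ℝ) : fourierTr q (-t) = starRingEnd ℂ (fourierTr q t) := by
  rw [fourierTr, fourierTr, ← integral_conj]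
  congr 1 with x
  rw [map_mul, ← Complex.exp_conj]
  simp

lemma continuous_fourierTr {q : ℝ → ℝ} (hq : Integrable q) : Continuous (fourierTr q) := by
  refine continuous_of_dominated (bound := fun x => |q x|)
    (fun t => (integrable_cexp_mul hq t).aestronglyMeasurable)
    (fun t => ae_of_all _ fun x => ?_) hq.abs (ae_of_all _ fun x => by fun_prop)
  rw [norm_mul, norm_cexp_I_mul, one_mul, Complex.norm_real, Real.norm_eq_abs]

lemma fourier_ofReal_eq_fourierTr (q : ℝ → ℝ) (w : ℝ) :
    FourierTransform.fourier (fun x => (q x : ℂ)) w = fourierTr q (-(2 * Real.pi * w)) := by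
  rw [Real.fourier_real_eq_integral_exp_smul, fourierTr]
  congr 1 with x
  rw [smul_eq_mul]
  congr 2
  push_cast
  ring

lemma tendsto_fourierTr_atTop (q : ℝ → ℝ) : Tendsto (fourierTr q) atTop (𝓝 0) := by
  have h1 := (Real.zero_at_infty_fourier fun x => (q x : ℂ)).comp
    ((tendsto_id.const_mul_atTop_of_neg (show -(2 * Real.pi)⁻¹ < 0 by
      have := Real.pi_pos; simp; positivity)).mono_right
      (_root_.atBot_le_cocompact))
  refine h1.congr fun t => ?_
  simp only [Function.comp, id, fourier_ofReal_eq_fourierTr]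
  congr 1
  have := Real.pi_pos
  field_simp

/-- An integrable continuous function whose Fourier transform vanishes off the origin is zero. -/
lemma eq_zero_of_fourierTr_eq_zero {q : ℝ → ℝ} (hq : Integrable q) (hc : Continuous q)
    (h0 : ∀ t, t ≠ 0 → fourierTr q t = 0) (x : ℝ) : q x = 0 := by
  have hae : FourierTransform.fourier (fun x => (q x : ℂ)) =ᵐ[volume] fun _ => (0 : ℂ) := by
    filter_upwards [compl_mem_ae_iff.2 (measure_singleton (0 : ℝ))] with w hw
    have hw : w ≠ 0 := hw
    rw [fourier_ofReal_eq_fourierTr]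
    exact h0 _ (by simpa using hw)
  have hinv := Continuous.fourierInv_fourier_eq (f := fun x => (q x : ℂ))
    (Complex.continuous_ofReal.comp hc) hq.ofReal ((integrable_zero _ _ _).congr hae.symm)
  have h2 := congrFun hinv x
  rw [Real.fourierInv_eq'] at h2
  have h3 : ∫ v : ℝ, Complex.exp (↑(2 * Real.pi * inner ℝ v x) * Complex.I) •
      FourierTransform.fourier (fun x => (q x : ℂ)) v = 0 := by
    rw [← integral_zero ℝ ℂ]
    refine integral_congr_ae ?_
    filter_upwards [hae] with v hv
    rw [hv, smul_zero]
  rw [h3] at h2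
  exact_mod_cast h2.symm

lemma I_mul_integral_cexp (t a : ℝ) :
    Complex.I * t * ∫ s in (0 : ℝ)..a, Complex.exp (Complex.I * t * s) =
      Complex.exp (Complex.I * t * a) - 1 := by
  rcases eq_or_ne t 0 with rfl | ht
  · simp
  · have hc : Complex.I * t ≠ 0 := mul_ne_zero Complex.I_ne_zero (by exact_mod_cast ht)
    rw [integral_exp_mul_complex hc]
    rw [mul_div_cancel₀ _ hc]
    simp

/-- The Fourier transform of the bias. The factor `I t` undoes the integration that leads from
the densities to the distribution functions. -/
lemma I_mul_fourierTr_cdfBias (hf : IsDensity f) (hk : IsKernel k) (h t : ℝ) :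
    Complex.I * t * fourierTr (cdfBias f k h) t =
      -(fourierTr f t * (fourierTr k (h * t) - 1)) := by
  have h1 := integrable_prod_mul_integrated_sub hf hk h 0
  simp only [zero_mul, sub_zero] at h1
  have h2 : Integrable (fun p : ℝ × ℝ => Complex.exp (Complex.I * t * p.1) *
      ((k p.2 * (integrated f (p.1 - h * p.2) - integrated f p.1) : ℝ) : ℂ))
      (volume.prod volume) :=
    h1.ofReal.bdd_mul (c := 1)
      ((continuous_cexp_I_mul t).comp continuous_fst).aestronglyMeasurable
      (ae_of_all _ fun p => (norm_cexp_I_mul t p.1).le)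
  have e1 : fourierTr (cdfBias f k h) t =
      ∫ y, (k y : ℂ) * -(fourierTr f t * ∫ s in (0 : ℝ)..(h * y),
        Complex.exp (Complex.I * t * s)) := by
    simp only [← fourierTr_integrated_sub hf.int]
    simp only [fourierTr, cdfBias_eq hf hk, ← integral_complex_ofReal, ← integral_const_mul]
    rw [integral_integral_swap h2]
    congr 1 with y
    congr 1 with x
    push_cast
    ring
  rw [e1, ← integral_const_mul]
  have e2 : ∀ y : ℝ, Complex.I * t * ((k y : ℂ) * -(fourierTr f t *
      ∫ s in (0 : ℝ)..(h * y), Complex.exp (Complex.I * t * s))) =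
      -fourierTr f t * (Complex.exp (Complex.I * (h * t : ℝ) * y) * k y - k y) := by
    intro y
    have := I_mul_integral_cexp t (h * y)
    rw [show Complex.I * ((h * t : ℝ) : ℂ) * y = Complex.I * t * ((h * y : ℝ) : ℂ) by
      push_cast; ring]
    linear_combination (-(k y : ℂ) * fourierTr f t) * this
  have hk' : Integrable fun y => (k y : ℂ) := hk.int.ofReal
  simp only [e2]
  rw [integral_const_mul, integral_sub (integrable_cexp_mul hk.int (h * t)) hk',
    integral_complex_ofReal, hk.mass, ← fourierTr, Complex.ofReal_one]
  ring

lemma sqBias_eq_zero_iff_fourierTr (hf : IsDensity f) (hk : IsKernel k) (h : ℝ) :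
    sqBias f k h = 0 ↔ ∀ t, fourierTr f t ≠ 0 → fourierTr k (h * t) = 1 := by
  rw [sqBias_eq_zero_iff hf hk]
  constructor
  · intro h0 t ht
    have h1 := I_mul_fourierTr_cdfBias hf hk h t
    have h2 : fourierTr (cdfBias f k h) t = 0 := by simp [fourierTr, h0]
    rw [h2, mul_zero, eq_comm, neg_eq_zero, mul_eq_zero, or_iff_right ht] at h1
    exact sub_eq_zero.1 h1
  · intro H
    refine eq_zero_of_fourierTr_eq_zero (integrable_cdfBias hf hk h)
      (continuous_cdfBias hf hk h) fun t ht => ?_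
    have h1 := I_mul_fourierTr_cdfBias hf hk h t
    have h2 : fourierTr f t * (fourierTr k (h * t) - 1) = 0 := by
      by_cases hft : fourierTr f t = 0
      · rw [hft, zero_mul]
      · rw [H t hft, sub_self, mul_zero]
    rw [h2, neg_zero, mul_eq_zero] at h1
    exact h1.resolve_left (mul_ne_zero Complex.I_ne_zero (by exact_mod_cast ht))

/-! ### The critical bandwidth -/

lemma freqS_ne_top (k : ℝ → ℝ) : freqS k ≠ ∞ := by
  have h1 : ∀ᶠ t in atTop, fourierTr k t ≠ 1 :=
    (tendsto_fourierTr_atTop k).eventually_ne zero_ne_one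
  obtain ⟨t, ht, ht0⟩ := (h1.and (eventually_ge_atTop 0)).exists
  exact ne_top_of_le_ne_top ENNReal.ofReal_ne_top (sInf_le ⟨t, ⟨ht0, ht⟩, rfl⟩)

lemma ofReal_le_freqD {t : ℝ} (h0 : 0 ≤ t) (ht : fourierTr f t ≠ 0) :
    ENNReal.ofReal t ≤ freqD f :=
  le_sSup ⟨t, ⟨h0, ht⟩, rfl⟩

lemma freqD_ne_zero (hf : IsKernel f) : freqD f ≠ 0 := by
  have h1 : fourierTr f 0 ≠ 0 := by simp [fourierTr_zero, hf.mass]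
  have h2 : ∀ᶠ t in 𝓝[>] (0 : ℝ), fourierTr f t ≠ 0 :=
    ((continuous_fourierTr hf.int).continuousAt.eventually_ne h1).filter_mono nhdsWithin_le_nhds
  obtain ⟨t, ht, ht0⟩ := (h2.and self_mem_nhdsWithin).exists
  have ht0 : 0 < t := ht0
  exact ((ENNReal.ofReal_pos.2 ht0).trans_le (ofReal_le_freqD ht0.le ht)).ne'

lemma freqS_div_freqD_ne_top (hf : IsKernel f) (k : ℝ → ℝ) : freqS k / freqD f ≠ ∞ :=
  ENNReal.div_ne_top (freqS_ne_top k) (freqD_ne_zero hf)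

lemma ofReal_le_freqS_div_freqD_iff (hf : IsKernel f) (k : ℝ → ℝ) (h : ℝ) :
    ENNReal.ofReal h ≤ freqS k / freqD f ↔ ENNReal.ofReal h * freqD f ≤ freqS k :=
  ENNReal.le_div_iff_mul_le (.inl (freqD_ne_zero hf)) (.inr (freqS_ne_top k))

lemma fourierTr_eq_one_of_le_freqS (hk : IsKernel k) {s : ℝ} (hs : 0 ≤ s)
    (hle : ENNReal.ofReal s ≤ freqS k) : fourierTr k s = 1 := by
  rcases hs.eq_or_lt with rfl | hs
  · simp [fourierTr_zero, hk.mass]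
  have hsub : Set.Ico 0 s ⊆ {t | fourierTr k t = 1} := by
    intro t ht
    by_contra hne
    exact absurd ((sInf_le ⟨t, ⟨ht.1, hne⟩, rfl⟩ : freqS k ≤ ENNReal.ofReal t).trans_lt
      ((ENNReal.ofReal_lt_ofReal_iff hs).2 ht.2)) hle.not_gt
  have hcl := (isClosed_eq (continuous_fourierTr hk.int) continuous_const).closure_subset_iff.2 hsub
  rw [closure_Ico hs.ne] at hcl
  exact hcl ⟨hs.le, le_rfl⟩

lemma exists_fourierTr_ne (hCD : freqC f = freqD f) (hST : freqS k = freqT k) {h : ℝ}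
    (hlt : freqS k < ENNReal.ofReal h * freqD f) :
    ∃ t, fourierTr f t ≠ 0 ∧ fourierTr k (h * t) ≠ 1 := by
  rw [hST, ← hCD] at hlt
  have hh : 0 < h := by
    by_contra hh
    simp [ENNReal.ofReal_of_nonpos (not_lt.1 hh)] at hlt
  obtain ⟨_, ⟨r, ⟨hr0, hr⟩, rfl⟩, hrlt⟩ := sInf_lt_iff.1 hlt
  have hdiv := ENNReal.div_lt_of_lt_mul' hrlt
  obtain ⟨_, ⟨r', ⟨hr'0, hr'⟩, rfl⟩, hrr'⟩ := lt_sSup_iff.1 hdiv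
  rw [← ENNReal.ofReal_div_of_pos hh] at hrr'
  have hrr : r / h < r' := (ENNReal.ofReal_lt_ofReal_iff_of_nonneg (by positivity)).1 hrr'
  have hscale : ∀ᵐ t : ℝ, r ≤ h * t → fourierTr k (h * t) ≠ 1 := by
    have hq : Measure.QuasiMeasurePreserving (fun t : ℝ => h * t) volume volume := by
      refine ⟨measurable_const_mul h, ?_⟩
      rw [Real.map_volume_mul_left hh.ne']
      exact Measure.smul_absolutelyContinuous
    exact hq.ae hr
  have hpos : volume (Set.Ioo (r / h) r') ≠ 0 := by
    rw [Real.volume_Ioo]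
    exact (ENNReal.ofReal_pos.2 (sub_pos.2 hrr)).ne'
  obtain ⟨t, ht, h1, h2⟩ : ∃ t ∈ Set.Ioo (r / h) r', (t ∈ Set.Icc 0 r' → fourierTr f t ≠ 0) ∧
      (r ≤ h * t → fourierTr k (h * t) ≠ 1) := by
    by_contra hcon
    push Not at hcon
    refine hpos (measure_mono_null (fun t ht => ?_) (ae_iff.1 (hr'.and hscale)))
    simp only [Set.mem_ofPred_eq, not_and]
    intro h1 h2
    exact absurd h2 (by have := hcon t ht h1; push Not; exact this)
  have ht0 : 0 ≤ t := (div_nonneg hr0 hh.le).trans ht.1.le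
  refine ⟨t, h1 ⟨ht0, ht.2.le⟩, h2 ?_⟩
  have := (div_lt_iff₀ hh).1 ht.1
  linarith

/-- The bandwidths without bias are those up to `S_k / D_f`. -/
lemma sqBias_eq_zero_iff_le (hf : IsDensity f) (hk : IsKernel k) (hCD : freqC f = freqD f)
    (hST : freqS k = freqT k) {h : ℝ} (h0 : 0 ≤ h) :
    sqBias f k h = 0 ↔ h ≤ (freqS k / freqD f).toReal := by
  rw [← ENNReal.ofReal_le_iff_le_toReal (freqS_div_freqD_ne_top hf.toIsKernel k),
    ofReal_le_freqS_div_freqD_iff hf.toIsKernel, sqBias_eq_zero_iff_fourierTr hf hk]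
  constructor
  · intro H
    by_contra hcon
    obtain ⟨t, h1, h2⟩ := exists_fourierTr_ne hCD hST (not_le.1 hcon)
    exact h2 (H t h1)
  · intro hle
    have key : ∀ t, 0 ≤ t → fourierTr f t ≠ 0 → fourierTr k (h * t) = 1 := by
      intro t ht hft
      refine fourierTr_eq_one_of_le_freqS hk (mul_nonneg h0 ht) (le_trans ?_ hle)
      rw [ENNReal.ofReal_mul h0]
      exact mul_le_mul_right (ofReal_le_freqD ht hft) _
    intro t hft
    rcases le_total 0 t with ht | ht
    · exact key t ht hft
    · have h1 : fourierTr f (-t) ≠ 0 := by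
        rw [fourierTr_neg]
        exact (map_ne_zero _).2 hft
      have h2 := key (-t) (by linarith) h1
      rw [mul_neg, fourierTr_neg] at h2
      simpa using congrArg (starRingEnd ℂ) h2

end

/-! ### The variance of a single summand -/

section

variable {f k : ℝ → ℝ}

/-- The contribution `K(x / h)` of an observation at the origin to the kernel estimator; the unit
step for `h = 0`. -/
noncomputable def smoothStep (k : ℝ → ℝ) (h x : ℝ) : ℝ :=
  if h = 0 then (Set.Ici 0).indicator (fun _ => (1 : ℝ)) x else integrated k (h⁻¹ * x)

lemma kernelCDF_eq (k : ℝ → ℝ) (n : ℕ) (h : ℝ) (s : ℕ → ℝ) (x : ℝ) :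
    kernelCDF k n h s x = (n : ℝ)⁻¹ * ∑ j ∈ Finset.range n, smoothStep k h (x - s j) := by
  unfold kernelCDF smoothStep
  split_ifs with hh
  · simp [empiricalCDF, Set.indicator_apply]
  · rfl

lemma measurable_smoothStep (hk : IsKernel k) (h : ℝ) : Measurable (smoothStep k h) := by
  unfold smoothStep
  split_ifs
  · exact measurable_const.indicator measurableSet_Ici
  · exact ((continuous_integrated hk.int).comp (by fun_prop)).measurable

lemma abs_smoothStep_le (hk : IsKernel k) (h x : ℝ) : |smoothStep k h x| ≤ ∫ y, |k y| := by
  unfold smoothStep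
  split_ifs
  · refine le_trans ?_ hk.one_le_integral_abs
    simp only [Set.indicator_apply]
    split_ifs <;> simp
  · exact abs_integrated_le hk.int _

lemma integrable_smoothStep_mul_one_sub (hk : IsKernel k) (h : ℝ) :
    Integrable fun x => smoothStep k h x * (1 - smoothStep k h x) := by
  unfold smoothStep
  split_ifs with hh
  · refine (integrable_zero ℝ ℝ _).congr (ae_of_all _ fun x => ?_)
    simp only [Set.indicator_apply]
    split_ifs <;> simp
  · exact (integrable_integrated_mul_one_sub hk.int hk.moment hk.mass).comp_mul_left'
      (inv_ne_zero hh)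

lemma integral_smoothStep_mul_one_sub (k : ℝ → ℝ) {h : ℝ} (h0 : 0 ≤ h) :
    ∫ x, smoothStep k h x * (1 - smoothStep k h x) = psi k * h := by
  unfold smoothStep
  split_ifs with hh
  · rw [hh, mul_zero, ← integral_zero ℝ ℝ]
    congr 1 with x
    simp only [Set.indicator_apply]
    split_ifs <;> simp
  · rw [Measure.integral_comp_mul_left (fun x => integrated k x * (1 - integrated k x)),
      inv_inv, abs_of_nonneg h0, smul_eq_mul, mul_comm, psi]

/-- The expectation of `K((x - X) / h)` when `X` has density `f`. -/
lemma integral_mul_smoothStep (hf : IsDensity f) (hk : IsKernel k) {h : ℝ} (h0 : 0 ≤ h) (x : ℝ) :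
    ∫ z, f z * smoothStep k h (x - z) = smoothedCDF f k h x := by
  unfold smoothStep
  split_ifs with hh
  · rw [hh, smoothedCDF_zero hk, integrated, ← integral_indicator measurableSet_Iic]
    congr 1 with z
    simp only [Set.indicator_apply, Set.mem_Ici, Set.mem_Iic, sub_nonneg, mul_ite, mul_one,
      mul_zero]
  · have hpos : 0 < h := lt_of_le_of_ne h0 (Ne.symm hh)
    have hmeas : MeasurableSet {p : ℝ × ℝ | h * p.2 ≤ x - p.1} :=
      measurableSet_le (by fun_prop) (by fun_prop)
    have hp : Integrable (fun p : ℝ × ℝ => {p : ℝ × ℝ | h * p.2 ≤ x - p.1}.indicator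
        (fun p => f p.1 * k p.2) p) (volume.prod volume) :=
      (hf.int.mul_prod hk.int).indicator hmeas
    have hswap := integral_integral_swap (f := fun z y =>
      {p : ℝ × ℝ | h * p.2 ≤ x - p.1}.indicator (fun p => f p.1 * k p.2) (z, y)) hp
    calc ∫ z, f z * integrated k (h⁻¹ * (x - z))
        = ∫ z, ∫ y, {p : ℝ × ℝ | h * p.2 ≤ x - p.1}.indicator
            (fun p => f p.1 * k p.2) (z, y) := by
          congr 1 with z
          rw [integrated, ← integral_indicator measurableSet_Iic, ← integral_const_mul]
          congr 1 with y
          simp only [Set.indicator_apply, Set.mem_Iic, Set.mem_ofPred_eq,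
            le_inv_mul_iff₀ hpos, mul_ite, mul_zero]
      _ = ∫ y, ∫ z, {p : ℝ × ℝ | h * p.2 ≤ x - p.1}.indicator
            (fun p => f p.1 * k p.2) (z, y) := hswap
      _ = smoothedCDF f k h x := by
          unfold smoothedCDF
          congr 1 with y
          rw [integrated, ← integral_indicator measurableSet_Iic, ← integral_const_mul]
          congr 1 with z
          simp only [Set.indicator_apply, Set.mem_Iic, Set.mem_ofPred_eq, mul_ite, mul_zero,
            le_sub_comm, mul_comm]

/-- The variance of `K((x - X) / h)` when `X` has density `f`. -/
noncomputable def stepVar (f k : ℝ → ℝ) (h x : ℝ) : ℝ :=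
  ∫ z, f z * (smoothStep k h (x - z) - smoothedCDF f k h x) ^ 2

lemma stepVar_nonneg (hf : IsDensity f) (k : ℝ → ℝ) (h x : ℝ) : 0 ≤ stepVar f k h x :=
  integral_nonneg fun z => mul_nonneg (hf.nonneg z) (sq_nonneg _)

lemma integrable_mul_smoothStep (hf : IsDensity f) (hk : IsKernel k) (h x : ℝ) :
    Integrable fun z => f z * smoothStep k h (x - z) :=
  hf.int.mul_bdd (c := ∫ y, |k y|)
    ((measurable_smoothStep hk h).comp (by fun_prop)).aestronglyMeasurable
    (ae_of_all _ fun _ => abs_smoothStep_le hk _ _)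

lemma integrable_mul_smoothStep_mul_one_sub (hf : IsDensity f) (hk : IsKernel k) (h x : ℝ) :
    Integrable fun z => f z * (smoothStep k h (x - z) * (1 - smoothStep k h (x - z))) := by
  have hm : Measurable fun z => smoothStep k h (x - z) :=
    (measurable_smoothStep hk h).comp (by fun_prop)
  refine ((integrable_mul_smoothStep hf hk h x).mul_bdd (c := 1 + ∫ y, |k y|)
    (measurable_const.sub hm).aestronglyMeasurable (ae_of_all _ fun z => ?_)).congr
    (ae_of_all _ fun z => mul_assoc _ _ _)
  refine (norm_sub_le _ _).trans (add_le_add (by simp) (abs_smoothStep_le hk _ _))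

lemma stepVar_eq (hf : IsDensity f) (hk : IsKernel k) {h : ℝ} (h0 : 0 ≤ h) (x : ℝ) :
    stepVar f k h x = smoothedCDF f k h x - smoothedCDF f k h x ^ 2 -
      ∫ z, f z * (smoothStep k h (x - z) * (1 - smoothStep k h (x - z))) := by
  set m := smoothedCDF f k h x with hm
  have i1 := integrable_mul_smoothStep hf hk h x
  have i2 := integrable_mul_smoothStep_mul_one_sub hf hk h x
  have e : ∀ z, f z * (smoothStep k h (x - z) - m) ^ 2 =
      (1 - 2 * m) * (f z * smoothStep k h (x - z)) + m ^ 2 * f z -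
        f z * (smoothStep k h (x - z) * (1 - smoothStep k h (x - z))) := fun z => by ring
  have i3 : Integrable fun z => (1 - 2 * m) * (f z * smoothStep k h (x - z)) + m ^ 2 * f z :=
    (i1.const_mul _).add (hf.int.const_mul _)
  rw [stepVar, ← hm]
  simp only [e]
  rw [integral_sub i3 i2, integral_add (i1.const_mul _) (hf.int.const_mul _),
    integral_const_mul, integral_const_mul, integral_mul_smoothStep hf hk h0, hf.mass, ← hm]
  ring

lemma integrable_convolution_smoothStep (hf : IsDensity f) (hk : IsKernel k) (h : ℝ) :
    Integrable fun x => ∫ z, f z * (smoothStep k h (x - z) * (1 - smoothStep k h (x - z))) :=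
  hf.int.integrable_convolution (ContinuousLinearMap.mul ℝ ℝ)
    (integrable_smoothStep_mul_one_sub hk h)

lemma integral_convolution_smoothStep (hf : IsDensity f) (hk : IsKernel k) {h : ℝ}
    (h0 : 0 ≤ h) :
    ∫ x, ∫ z, f z * (smoothStep k h (x - z) * (1 - smoothStep k h (x - z))) = psi k * h := by
  have := integral_convolution (μ := volume) (ContinuousLinearMap.mul ℝ ℝ) hf.int
    (integrable_smoothStep_mul_one_sub hk h)
  rw [ContinuousLinearMap.mul_apply', hf.mass, one_mul, integral_smoothStep_mul_one_sub k h0] at this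
  exact this

/-- The variance is `m (1 - m)` minus a convolution, where `m = F + bias`; expand `m (1 - m)`
around `F`. -/
lemma stepVar_eq_add (hf : IsDensity f) (hk : IsKernel k) {h : ℝ} (h0 : 0 ≤ h) (x : ℝ) :
    stepVar f k h x = (integrated f x * (1 - integrated f x) +
      (cdfBias f k h x * (1 - 2 * integrated f x) - cdfBias f k h x ^ 2)) -
      ∫ z, f z * (smoothStep k h (x - z) * (1 - smoothStep k h (x - z))) := by
  rw [stepVar_eq hf hk h0, cdfBias]
  ring

lemma integrable_integrated_mul_one_sub_add (hf : IsDensity f) (hk : IsKernel k) (h : ℝ) :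
    Integrable fun x => integrated f x * (1 - integrated f x) +
      (cdfBias f k h x * (1 - 2 * integrated f x) - cdfBias f k h x ^ 2) :=
  (integrable_integrated_mul_one_sub hf.int hf.moment hf.mass).add
    ((integrable_cdfBias_mul hf hk h).sub (integrable_cdfBias_sq hf hk h))

lemma integrable_stepVar (hf : IsDensity f) (hk : IsKernel k) {h : ℝ} (h0 : 0 ≤ h) :
    Integrable (stepVar f k h) :=
  ((integrable_integrated_mul_one_sub_add hf hk h).sub
    (integrable_convolution_smoothStep hf hk h)).congr
    (ae_of_all _ fun x => (stepVar_eq_add hf hk h0 x).symm)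

/-- The integrated variance of a summand of the kernel estimator, in terms of `ψ` and the bias;
`integral_stepVar` identifies it with the integral of the pointwise variance. -/
noncomputable def intVar (f k : ℝ → ℝ) (h : ℝ) : ℝ :=
  psi f - psi k * h + crossBias f k h - sqBias f k h

lemma integral_stepVar (hf : IsDensity f) (hk : IsKernel k) {h : ℝ} (h0 : 0 ≤ h) :
    ∫ x, stepVar f k h x = intVar f k h := by
  have hd : Integrable fun x => cdfBias f k h x * (1 - 2 * integrated f x) -
      cdfBias f k h x ^ 2 := (integrable_cdfBias_mul hf hk h).sub (integrable_cdfBias_sq hf hk h)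
  simp only [stepVar_eq_add hf hk h0]
  rw [integral_sub (integrable_integrated_mul_one_sub_add hf hk h)
      (integrable_convolution_smoothStep hf hk h),
    integral_add (integrable_integrated_mul_one_sub hf.int hf.moment hf.mass) hd,
    integral_sub (integrable_cdfBias_mul hf hk h) (integrable_cdfBias_sq hf hk h),
    integral_convolution_smoothStep hf hk h0]
  simp only [intVar, psi, crossBias, sqBias]
  ring

lemma intVar_nonneg (hf : IsDensity f) (hk : IsKernel k) {h : ℝ} (h0 : 0 ≤ h) :
    0 ≤ intVar f k h := by
  rw [← integral_stepVar hf hk h0]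
  exact integral_nonneg fun x => stepVar_nonneg hf k h x

/-- If the variance vanished, `K` would be periodic, which its limits `0` and `1` exclude. -/
lemma intVar_pos (hf : IsDensity f) (hk : IsKernel k) {h : ℝ} (hpos : 0 < h) :
    0 < intVar f k h := by
  refine (intVar_nonneg hf hk hpos.le).lt_of_ne fun h0 => ?_
  rw [← integral_stepVar hf hk hpos.le, eq_comm, integral_eq_zero_iff_of_nonneg
    (fun x => stepVar_nonneg hf k h x) (integrable_stepVar hf hk hpos.le)] at h0
  have hK : ∀ x, smoothStep k h x = integrated k (h⁻¹ * x) := fun x => if_neg hpos.ne'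
  have hcK := continuous_integrated hk.int
  have hcm := continuous_smoothedCDF hf hk h
  have hae : ∀ᵐ x : ℝ, ∀ᵐ z : ℝ, f z * (integrated k (h⁻¹ * (x - z)) -
      smoothedCDF f k h x) ^ 2 = 0 := by
    filter_upwards [h0] with x hx
    have hi : Integrable fun z => f z * (smoothStep k h (x - z) - smoothedCDF f k h x) ^ 2 := by
      have hm : Measurable fun z => smoothStep k h (x - z) :=
        (measurable_smoothStep hk h).comp (by fun_prop)
      refine hf.int.mul_bdd (c := (2 * ∫ y, |k y|) ^ 2)
        ((hm.sub_const _).pow_const 2).aestronglyMeasurable (ae_of_all _ fun z => ?_)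
      rw [norm_pow]
      refine pow_le_pow_left₀ (norm_nonneg _) ((norm_sub_le _ _).trans ?_) 2
      rw [two_mul]
      exact add_le_add (abs_smoothStep_le hk _ _) (abs_smoothedCDF_le hf hk _ _)
    have := (integral_eq_zero_iff_of_nonneg
      (fun z => mul_nonneg (hf.nonneg z) (sq_nonneg _)) hi).1 hx
    filter_upwards [this] with z hz
    simpa only [hK, Pi.zero_apply] using hz
  -- exchanging the two quantifiers needs a measurable set, hence a measurable version of `f`
  have hae2 : ∀ᵐ z : ℝ, ∀ᵐ x : ℝ, f z * (integrated k (h⁻¹ * (x - z)) -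
      smoothedCDF f k h x) ^ 2 = 0 := by
    obtain ⟨f', hf'm, hff'⟩ := hf.int.aestronglyMeasurable
    have h1 : ∀ᵐ x : ℝ, ∀ᵐ z : ℝ, f' z * (integrated k (h⁻¹ * (x - z)) -
        smoothedCDF f k h x) ^ 2 = 0 := by
      filter_upwards [hae] with x hx
      filter_upwards [hx, hff'] with z hz hfz
      rwa [← hfz]
    have hset : MeasurableSet {p : ℝ × ℝ | f' p.2 * (integrated k (h⁻¹ * (p.1 - p.2)) -
        smoothedCDF f k h p.1) ^ 2 = 0} := by
      refine measurableSet_eq_fun ((hf'm.measurable.comp measurable_snd).mul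
        (Continuous.measurable ?_)) measurable_const
      exact ((hcK.comp (by fun_prop)).sub (hcm.comp continuous_fst)).pow 2
    have h2 := (Measure.ae_ae_comm (μ := volume) (ν := volume)
      (p := fun x z : ℝ => f' z * (integrated k (h⁻¹ * (x - z)) -
        smoothedCDF f k h x) ^ 2 = 0) hset).1 h1
    filter_upwards [h2, hff'] with z hz hfz
    rwa [hfz]
  -- for almost every `z` in the support, the translate of `K` by `z` is the mean
  have htr : ∀ᵐ z : ℝ, f z ≠ 0 → ∀ x, integrated k (h⁻¹ * (x - z)) = smoothedCDF f k h x := by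
    filter_upwards [hae2] with z hz hfz
    have : (fun x => integrated k (h⁻¹ * (x - z))) =ᵐ[volume] smoothedCDF f k h := by
      filter_upwards [hz] with x hx
      rw [mul_eq_zero, or_iff_right hfz] at hx
      exact sub_eq_zero.1 (pow_eq_zero_iff two_ne_zero |>.1 hx)
    exact fun x => congrFun ((Continuous.ae_eq_iff_eq volume (hcK.comp (by fun_prop)) hcm).1 this) x
  have hex : ∀ z₀ : ℝ, ∃ z, z ≠ z₀ ∧ f z ≠ 0 ∧
      ∀ x, integrated k (h⁻¹ * (x - z)) = smoothedCDF f k h x := by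
    intro z₀
    by_contra hcon
    push Not at hcon
    have hz : f =ᵐ[volume] 0 := by
      filter_upwards [htr, compl_mem_ae_iff.2 (measure_singleton z₀)] with z hz hne
      by_contra hfz
      obtain ⟨x, hx⟩ := hcon z hne hfz
      exact hx (hz hfz x)
    have := hf.mass
    rw [integral_congr_ae hz] at this
    simp at this
  obtain ⟨z₁, -, -, h1⟩ := hex 0
  obtain ⟨z₂, hne, -, h2⟩ := hex z₁
  have hint := integral_integrated_sub hk.int (h⁻¹ * (z₂ - z₁))
  have hzero : ∀ x, integrated k (x - h⁻¹ * (z₂ - z₁)) - integrated k x = 0 := by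
    intro x
    have e1 := h1 (h * x + z₁)
    have e2 := h2 (h * x + z₁)
    rw [show h⁻¹ * (h * x + z₁ - z₁) = x by field_simp; ring] at e1
    rw [show h⁻¹ * (h * x + z₁ - z₂) = x - h⁻¹ * (z₂ - z₁) by field_simp; ring] at e2
    rw [e1, e2, sub_self]
  simp only [hzero, integral_zero, hk.mass, mul_one] at hint
  have : h⁻¹ * (z₂ - z₁) = 0 := by linarith
  rw [mul_eq_zero, or_iff_right (inv_ne_zero hpos.ne')] at this
  exact hne (sub_eq_zero.1 this)

end

/-! ### Mean and mean square of the estimator -/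

section

variable {Ω : Type*} [MeasurableSpace Ω] {P : Measure Ω} {f k : ℝ → ℝ} {X : ℕ → Ω → ℝ}

lemma integral_comp_of_hasLaw (hf : IsDensity f) {Y : Ω → ℝ}
    (hY : HasLaw Y (volume.withDensity fun x => ENNReal.ofReal (f x)) P) {g : ℝ → ℝ}
    (hg : Measurable g) : ∫ ω, g (Y ω) ∂P = ∫ z, f z * g z := by
  have h1 := hY.integral_comp hg.aestronglyMeasurable
  rw [integral_withDensity_eq_integral_toReal_smul₀ hf.int.aemeasurable.ennreal_ofReal
    (ae_of_all _ fun _ => ENNReal.ofReal_lt_top)] at h1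
  refine h1.trans (integral_congr_ae (ae_of_all _ fun z => ?_))
  simp only [ENNReal.toReal_ofReal (hf.nonneg z), smul_eq_mul]

lemma integral_smoothStep (hf : IsDensity f) (hk : IsKernel k) {Y : Ω → ℝ}
    (hY : HasLaw Y (volume.withDensity fun x => ENNReal.ofReal (f x)) P) {h : ℝ} (h0 : 0 ≤ h)
    (x : ℝ) : ∫ ω, smoothStep k h (x - Y ω) ∂P = smoothedCDF f k h x := by
  rw [integral_comp_of_hasLaw hf hY (g := fun z => smoothStep k h (x - z))
    ((measurable_smoothStep hk h).comp (by fun_prop)), integral_mul_smoothStep hf hk h0]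

variable [IsProbabilityMeasure P]

lemma memLp_smoothStep (hk : IsKernel k) {Y : Ω → ℝ} (hY : AEMeasurable Y P) (h x : ℝ) :
    MemLp (fun ω => smoothStep k h (x - Y ω)) 2 P :=
  MemLp.of_bound ((measurable_smoothStep hk h).comp_aemeasurable
    (hY.const_sub x)).aestronglyMeasurable (∫ y, |k y|)
    (ae_of_all _ fun _ => abs_smoothStep_le hk _ _)

lemma variance_smoothStep (hf : IsDensity f) (hk : IsKernel k) {Y : Ω → ℝ}
    (hY : HasLaw Y (volume.withDensity fun x => ENNReal.ofReal (f x)) P) {h : ℝ} (h0 : 0 ≤ h)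
    (x : ℝ) : variance (fun ω => smoothStep k h (x - Y ω)) P = stepVar f k h x := by
  rw [variance_eq_integral (memLp_smoothStep hk hY.aemeasurable h x).aemeasurable,
    integral_smoothStep hf hk hY h0]
  exact integral_comp_of_hasLaw hf hY
    (g := fun z => (smoothStep k h (x - z) - smoothedCDF f k h x) ^ 2)
    ((((measurable_smoothStep hk h).comp (by fun_prop)).sub_const _).pow_const 2)

lemma memLp_kernelCDF (hk : IsKernel k)
    (hX : ∀ j, HasLaw (X j) (volume.withDensity fun x => ENNReal.ofReal (f x)) P)
    (n : ℕ) (h x : ℝ) : MemLp (fun ω => kernelCDF k n h (fun j => X j ω) x) 2 P := by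
  simp only [kernelCDF_eq]
  exact (memLp_finsetSum _ fun j _ => memLp_smoothStep hk (hX j).aemeasurable h x).const_mul _

lemma memLp_kernelCDF_sub_const (hk : IsKernel k)
    (hX : ∀ j, HasLaw (X j) (volume.withDensity fun x => ENNReal.ofReal (f x)) P)
    (n : ℕ) (h x c : ℝ) : MemLp (fun ω => kernelCDF k n h (fun j => X j ω) x - c) 2 P :=
  (memLp_kernelCDF hk hX n h x).sub (memLp_const c)

lemma integral_kernelCDF (hf : IsDensity f) (hk : IsKernel k)
    (hX : ∀ j, HasLaw (X j) (volume.withDensity fun x => ENNReal.ofReal (f x)) P)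
    {n : ℕ} (hn : 1 ≤ n) {h : ℝ} (h0 : 0 ≤ h) (x : ℝ) :
    ∫ ω, kernelCDF k n h (fun j => X j ω) x ∂P = smoothedCDF f k h x := by
  have hn' : (n : ℝ) ≠ 0 := by positivity
  simp only [kernelCDF_eq]
  rw [integral_const_mul, integral_finsetSum _ fun j _ =>
    (memLp_smoothStep hk (hX j).aemeasurable h x).integrable one_le_two]
  simp only [integral_smoothStep hf hk (hX _) h0, Finset.sum_const, Finset.card_range, nsmul_eq_mul]
  field_simp

lemma variance_kernelCDF (hf : IsDensity f) (hk : IsKernel k) (hind : iIndepFun X P)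
    (hX : ∀ j, HasLaw (X j) (volume.withDensity fun x => ENNReal.ofReal (f x)) P)
    {n : ℕ} (hn : 1 ≤ n) {h : ℝ} (h0 : 0 ≤ h) (x : ℝ) :
    variance (fun ω => kernelCDF k n h (fun j => X j ω) x) P =
      (n : ℝ)⁻¹ * stepVar f k h x := by
  have hn' : (n : ℝ) ≠ 0 := by positivity
  have hm : Measurable fun z => smoothStep k h (x - z) :=
    (measurable_smoothStep hk h).comp (by fun_prop)
  have hsum := IndepFun.variance_sum (μ := P) (s := Finset.range n)
    (X := fun j ω => smoothStep k h (x - X j ω))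
    (fun j _ => memLp_smoothStep hk (hX j).aemeasurable h x)
    (fun i _ j _ hij => (hind.indepFun hij).comp hm hm)
  simp only [kernelCDF_eq]
  rw [variance_const_mul]
  have e : (fun ω => ∑ j ∈ Finset.range n, smoothStep k h (x - X j ω)) =
      ∑ j ∈ Finset.range n, fun ω => smoothStep k h (x - X j ω) := by
    ext ω
    simp
  rw [e, hsum]
  simp only [variance_smoothStep hf hk (hX _) h0, Finset.sum_const, Finset.card_range, nsmul_eq_mul]
  field_simp

/-- Decomposition of the mean square error at a point into variance and squared bias. -/
lemma integral_kernelCDF_sub_sq (hf : IsDensity f) (hk : IsKernel k) (hind : iIndepFun X P)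
    (hX : ∀ j, HasLaw (X j) (volume.withDensity fun x => ENNReal.ofReal (f x)) P)
    {n : ℕ} (hn : 1 ≤ n) {h : ℝ} (h0 : 0 ≤ h) (x : ℝ) :
    ∫ ω, (kernelCDF k n h (fun j => X j ω) x - integrated f x) ^ 2 ∂P =
      cdfBias f k h x ^ 2 + (n : ℝ)⁻¹ * stepVar f k h x := by
  have hL := memLp_kernelCDF (P := P) hk hX n h x
  have hv := variance_sub_const hL.aestronglyMeasurable (integrated f x)
  rw [variance_kernelCDF hf hk hind hX hn h0,
    variance_eq_sub (memLp_kernelCDF_sub_const hk hX n h x _)] at hv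
  simp only [Pi.pow_apply] at hv
  rw [integral_sub (hL.integrable one_le_two) (integrable_const _),
    integral_kernelCDF hf hk hX hn h0, integral_const, probReal_univ, one_smul] at hv
  rw [cdfBias]
  linarith

lemma isb_eq (hf : IsDensity f) (hk : IsKernel k)
    (hX : ∀ j, HasLaw (X j) (volume.withDensity fun x => ENNReal.ofReal (f x)) P)
    {n : ℕ} (hn : 1 ≤ n) {h : ℝ} (h0 : 0 ≤ h) :
    isb P X f k n h = ENNReal.ofReal (sqBias f k h) := by
  simp only [isb, integral_kernelCDF hf hk hX hn h0]
  exact lintegral_ofReal_cdfBias_sq hf hk h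

/-- The mean integrated squared error for sample size `n` as a real function of the bandwidth:
integrated squared bias plus integrated variance. -/
noncomputable def miseReal (f k : ℝ → ℝ) (n : ℕ) (h : ℝ) : ℝ :=
  sqBias f k h + (n : ℝ)⁻¹ * intVar f k h

lemma miseReal_nonneg (hf : IsDensity f) (hk : IsKernel k) (n : ℕ) {h : ℝ} (h0 : 0 ≤ h) :
    0 ≤ miseReal f k n h :=
  add_nonneg (sqBias_nonneg f k h) (mul_nonneg (by positivity) (intVar_nonneg hf hk h0))

lemma mise_eq (hf : IsDensity f) (hk : IsKernel k) (hind : iIndepFun X P)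
    (hX : ∀ j, HasLaw (X j) (volume.withDensity fun x => ENNReal.ofReal (f x)) P)
    {n : ℕ} (hn : 1 ≤ n) {h : ℝ} (h0 : 0 ≤ h) :
    mise P X f k n h = ENNReal.ofReal (miseReal f k n h) := by
  have hmeas : AEMeasurable (fun p : Ω × ℝ => ENNReal.ofReal
      ((kernelCDF k n h (fun j => X j p.1) p.2 - integrated f p.2) ^ 2)) (P.prod volume) := by
    simp only [kernelCDF_eq]
    refine (((Finset.aemeasurable_fun_sum _ fun j _ => ?_).const_mul _).sub
      ((continuous_integrated hf.int).measurable.comp measurable_snd).aemeasurable).pow_const 2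
      |>.ennreal_ofReal
    exact (measurable_smoothStep hk h).comp_aemeasurable
      (measurable_snd.aemeasurable.sub (hX j).aemeasurable.comp_fst)
  rw [mise, lintegral_lintegral_swap hmeas]
  have e : ∀ x, ∫⁻ ω, ENNReal.ofReal
      ((kernelCDF k n h (fun j => X j ω) x - integrated f x) ^ 2) ∂P =
      ENNReal.ofReal (cdfBias f k h x ^ 2 + (n : ℝ)⁻¹ * stepVar f k h x) := by
    intro x
    rw [← integral_kernelCDF_sub_sq hf hk hind hX hn h0, ofReal_integral_eq_lintegral_ofReal
      (memLp_kernelCDF_sub_const hk hX n h x _).integrable_sq (ae_of_all _ fun _ => sq_nonneg _)]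
  simp only [e]
  have hi := (integrable_stepVar hf hk h0).const_mul (n : ℝ)⁻¹
  have hi' : Integrable fun x => cdfBias f k h x ^ 2 + (n : ℝ)⁻¹ * stepVar f k h x :=
    (integrable_cdfBias_sq hf hk h).add hi
  rw [← ofReal_integral_eq_lintegral_ofReal hi'
    (ae_of_all _ fun x => add_nonneg (sq_nonneg _)
      (mul_nonneg (by positivity) (stepVar_nonneg hf k h x))),
    integral_add (integrable_cdfBias_sq hf hk h) hi, integral_const_mul, integral_stepVar hf hk h0]
  rfl

end

/-! ### Optimal bandwidths -/

section

variable {f k : ℝ → ℝ}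

lemma continuous_miseReal (hf : IsDensity f) (hk : IsKernel k) (n : ℕ) :
    Continuous (miseReal f k n) := by
  have h1 := continuous_sqBias hf hk
  have h2 := continuous_crossBias hf hk
  unfold miseReal intVar
  fun_prop

lemma sqBias_le_miseReal (hf : IsDensity f) (hk : IsKernel k) (n : ℕ) {h : ℝ} (h0 : 0 ≤ h) :
    sqBias f k h ≤ miseReal f k n h :=
  le_add_of_nonneg_right (mul_nonneg (by positivity) (intVar_nonneg hf hk h0))

lemma miseReal_of_sqBias_eq_zero (hf : IsDensity f) (hk : IsKernel k) (n : ℕ) {h : ℝ}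
    (hz : sqBias f k h = 0) : miseReal f k n h = (n : ℝ)⁻¹ * (psi f - psi k * h) := by
  rw [miseReal, intVar, hz, crossBias_eq_zero hf hk hz]
  ring

lemma sqBias_zero (f : ℝ → ℝ) (hk : IsKernel k) : sqBias f k 0 = 0 := by
  simp [sqBias, cdfBias, smoothedCDF_zero hk]

lemma miseReal_zero (hf : IsDensity f) (hk : IsKernel k) (n : ℕ) :
    miseReal f k n 0 = (n : ℝ)⁻¹ * psi f := by
  rw [miseReal_of_sqBias_eq_zero hf hk n (sqBias_zero f hk), mul_zero, sub_zero]

/-- A small amount of smoothing strictly improves on the empirical distribution function: the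
variance decreases by `ψ(K) h / n`, while the bias terms are `o(h)`. -/
lemma exists_miseReal_lt (hf : IsDensity f) (hk : IsKernel k) (hpsi : 0 < psi k) {n : ℕ}
    (hn : 1 ≤ n) : ∃ h, 0 < h ∧ miseReal f k n h < miseReal f k n 0 := by
  have hn' : (1 : ℝ) ≤ n := by exact_mod_cast hn
  set A := ∫ y, |k y| with hA
  have hA1 : 1 ≤ A := hk.one_le_integral_abs
  have hc : 0 < psi k / (n * A + 1) := by positivity
  obtain ⟨h, hlt, hpos⟩ := (((tendsto_inv_mul_integral_shiftEnergy hf hk).eventually_lt_const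
    hc).and self_mem_nhdsWithin).exists
  have hpos : 0 < h := hpos
  refine ⟨h, hpos, ?_⟩
  rw [miseReal_zero hf hk]
  have h1 := sqBias_le hf hk h
  have h2 := crossBias_le hf hk h
  set S := ∫ y, |k y| * shiftEnergy f (h * y)
  rw [inv_mul_lt_iff₀ hpos, mul_div_assoc', lt_div_iff₀ (by positivity)] at hlt
  have h3 : miseReal f k n h = (n : ℝ)⁻¹ * (psi f - psi k * h + crossBias f k h +
      (n - 1) * sqBias f k h) := by
    rw [miseReal, intVar]
    field_simp
    ring
  rw [h3]
  refine mul_lt_mul_of_pos_left ?_ (by positivity)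
  have h4 : (n - 1) * sqBias f k h ≤ n * (A * S) := by
    have h5 := sqBias_nonneg f k h
    nlinarith
  nlinarith

lemma tendsto_miseReal_atTop (hf : IsDensity f) (hk : IsKernel k) (n : ℕ) :
    Tendsto (miseReal f k n) atTop atTop := by
  refine tendsto_atTop_mono' _ ?_ (tendsto_sqBias_atTop hf hk)
  filter_upwards [eventually_ge_atTop 0] with h h0 using sqBias_le_miseReal hf hk n h0

lemma exists_forall_miseReal_le (hf : IsDensity f) (hk : IsKernel k) (hpsi : 0 < psi k) {n : ℕ}
    (hn : 1 ≤ n) : ∃ h, 0 < h ∧ ∀ h', 0 < h' → miseReal f k n h ≤ miseReal f k n h' := by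
  obtain ⟨M, hM⟩ := eventually_atTop.1
    ((tendsto_miseReal_atTop hf hk n).eventually_gt_atTop (miseReal f k n 0))
  obtain ⟨h₁, h₁pos, h₁lt⟩ := exists_miseReal_lt hf hk hpsi hn
  have hM₁ : h₁ < M := by
    by_contra hcon
    exact absurd (hM h₁ (not_lt.1 hcon)) h₁lt.not_gt
  obtain ⟨h, ⟨hh0, hhM⟩, hmin⟩ := isCompact_Icc.exists_isMinOn
    (Set.nonempty_Icc.2 (h₁pos.trans hM₁).le) (continuous_miseReal hf hk n).continuousOn
  have hlt : miseReal f k n h < miseReal f k n 0 := (hmin ⟨h₁pos.le, hM₁.le⟩).trans_lt h₁lt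
  refine ⟨h, hh0.lt_of_ne (by rintro rfl; exact lt_irrefl _ hlt), fun h' h'0 => ?_⟩
  rcases le_total h' M with hle | hle
  · exact hmin ⟨h'0.le, hle⟩
  · exact hlt.le.trans (hM h' hle).le

/-- Minimizers converge to the end of the interval of unbiased bandwidths: on that interval the
risk is strictly decreasing, and beyond it the bias does not tend to zero with `n`. -/
lemma tendsto_of_forall_miseReal_le (hf : IsDensity f) (hk : IsKernel k) (hpsi : 0 < psi k)
    {b : ℝ} (hb : ∀ h, 0 ≤ h → (sqBias f k h = 0 ↔ h ≤ b)) {h₀ : ℕ → ℝ}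
    (hopt : ∀ n : ℕ, 1 ≤ n → 0 < h₀ n ∧ ∀ h', 0 < h' → miseReal f k n (h₀ n) ≤ miseReal f k n h') :
    Tendsto h₀ atTop (𝓝 b) := by
  have hlow : ∀ n : ℕ, 1 ≤ n → b ≤ h₀ n := by
    intro n hn
    by_contra! hlt
    obtain ⟨hpos, hmin⟩ := hopt n hn
    have h1 := hmin b (hpos.trans hlt)
    rw [miseReal_of_sqBias_eq_zero hf hk n ((hb _ hpos.le).2 hlt.le),
      miseReal_of_sqBias_eq_zero hf hk n ((hb _ (hpos.trans hlt).le).2 le_rfl)] at h1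
    have hn' : (0 : ℝ) < (n : ℝ)⁻¹ := by positivity
    have h2 := le_of_mul_le_mul_left h1 hn'
    nlinarith
  have hsq : ∀ n : ℕ, 1 ≤ n → sqBias f k (h₀ n) ≤ (n : ℝ)⁻¹ * psi f := by
    intro n hn
    obtain ⟨hpos, hmin⟩ := hopt n hn
    obtain ⟨h₁, h₁pos, h₁lt⟩ := exists_miseReal_lt hf hk hpsi hn
    rw [← miseReal_zero hf hk]
    exact (sqBias_le_miseReal hf hk n hpos.le).trans ((hmin h₁ h₁pos).trans h₁lt.le)
  refine tendsto_order.2 ⟨fun a ha => ?_, fun a ha => ?_⟩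
  · filter_upwards [eventually_ge_atTop 1] with n hn using ha.trans_le (hlow n hn)
  obtain ⟨δ, hδ, hδle⟩ : ∃ δ > 0, ∀ h, 0 ≤ h → a ≤ h → δ ≤ sqBias f k h := by
    obtain ⟨M, hM⟩ := eventually_atTop.1 ((tendsto_sqBias_atTop hf hk).eventually_ge_atTop 1)
    have hpos : ∀ h, 0 ≤ h → a ≤ h → 0 < sqBias f k h := fun h h0 hah =>
      (sqBias_nonneg f k h).lt_of_ne fun hz =>
        absurd ((hb h h0).1 hz.symm) (not_le.2 (ha.trans_le hah))
    rcases (Set.Icc (max a 0) M).eq_empty_or_nonempty with hemp | hne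
    · refine ⟨1, one_pos, fun h h0 hah => hM h ?_⟩
      rw [Set.Icc_eq_empty_iff, not_le] at hemp
      exact hemp.le.trans (max_le hah h0)
    · obtain ⟨m, ⟨hm1, hm2⟩, hmin⟩ := isCompact_Icc.exists_isMinOn hne
        (continuous_sqBias hf hk).continuousOn
      refine ⟨min 1 (sqBias f k m), lt_min one_pos
        (hpos m ((le_max_right _ _).trans hm1) ((le_max_left _ _).trans hm1)),
        fun h h0 hah => ?_⟩
      rcases le_total h M with hle | hle
      · exact (min_le_right _ _).trans (hmin ⟨max_le hah h0, hle⟩)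
      · exact (min_le_left _ _).trans (hM h hle)
  have hlim : Tendsto (fun n : ℕ => (n : ℝ)⁻¹ * psi f) atTop (𝓝 0) := by
    simpa using (tendsto_inv_atTop_zero.comp tendsto_natCast_atTop_atTop).mul_const (psi f)
  filter_upwards [hlim.eventually_lt_const hδ, eventually_ge_atTop 1] with n hn hn1
  by_contra! hle
  exact absurd ((hδle _ (hopt n hn1).1.le hle).trans (hsq n hn1)) (not_le.2 hn)

end

theorem theorem2 {Ω : Type*} [MeasurableSpace Ω] (P : Measure Ω) [IsProbabilityMeasure P]
    (f k : ℝ → ℝ)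
    -- `f` is a probability density with finite first moment
    (hf_nonneg : ∀ x, 0 ≤ f x) (hf_int : Integrable f) (hf_one : ∫ x, f x = 1)
    (hf_mom : Integrable (fun x => x * f x))
    -- `k` is a kernel with finite first absolute moment
    (hk_int : Integrable k) (hk_one : ∫ x, k x = 1)
    (hk_mom : Integrable (fun y => y * k y))
    -- `X 0, X 1, …` are independent random variables with density `f`
    (X : ℕ → Ω → ℝ) (hX_indep : iIndepFun X P)
    (hX_law : ∀ j, HasLaw (X j) (volume.withDensity (fun x => ENNReal.ofReal (f x))) P)
    (hpsi : 0 < psi k)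
    (hCD : freqC f = freqD f) (hST : freqS k = freqT k) :
    -- the limit is a finite number
    freqS k / freqD f ≠ ∞ ∧
    -- optimal bandwidths exist, and every choice of them converges to the limit
    (∀ n : ℕ, 1 ≤ n → ∃ h : ℝ, IsOptimalBandwidth P X f k n h) ∧
    (∀ h₀ : ℕ → ℝ, (∀ n : ℕ, 1 ≤ n → IsOptimalBandwidth P X f k n (h₀ n)) →
      Tendsto h₀ atTop (𝓝 (freqS k / freqD f).toReal)) ∧
    (∀ n : ℕ, 1 ≤ n → hStar P X f k n = freqS k / freqD f) ∧
    -- the exact MISE for bandwidths up to the limit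
    (∀ n : ℕ, 1 ≤ n → ∀ h : ℝ, 0 ≤ h → ENNReal.ofReal h ≤ freqS k / freqD f →
      mise P X f k n h ≠ ∞ ∧
      (mise P X f k n h).toReal = (n : ℝ)⁻¹ * (psi f - psi k * h)) ∧
    -- first-order improvement over the empirical estimator
    (∀ h : ℝ, 0 < h → ENNReal.ofReal h ≤ freqS k / freqD f →
      0 < psi f - psi k * h ∧ psi f - psi k * h < psi f ∧
      ∀ n : ℕ, 1 ≤ n → mise P X f k n h < mise P X f k n 0) := by
  have hf : IsDensity f := ⟨⟨hf_int, hf_one, hf_mom⟩, hf_nonneg⟩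
  have hk : IsKernel k := ⟨hk_int, hk_one, hk_mom⟩
  have htop := freqS_div_freqD_ne_top hf.toIsKernel k
  set b := freqS k / freqD f with hbdef
  have hb : ∀ h, 0 ≤ h → (sqBias f k h = 0 ↔ h ≤ b.toReal) := fun h h0 =>
    sqBias_eq_zero_iff_le hf hk hCD hST h0
  have hmise : ∀ n : ℕ, 1 ≤ n → ∀ h : ℝ, 0 ≤ h →
      mise P X f k n h = ENNReal.ofReal (miseReal f k n h) := fun n hn h h0 =>
    mise_eq hf hk hX_indep hX_law hn h0
  have hopt : ∀ n : ℕ, 1 ≤ n → ∀ h : ℝ, IsOptimalBandwidth P X f k n h ↔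
      0 < h ∧ ∀ h', 0 < h' → miseReal f k n h ≤ miseReal f k n h' := by
    intro n hn h
    refine and_congr_right fun hpos => forall₂_congr fun h' hpos' => ?_
    rw [hmise n hn h hpos.le, hmise n hn h' hpos'.le,
      ENNReal.ofReal_le_ofReal_iff (miseReal_nonneg hf hk n hpos'.le)]
  have hexact : ∀ n : ℕ, ∀ h : ℝ, 0 ≤ h → ENNReal.ofReal h ≤ b →
      miseReal f k n h = (n : ℝ)⁻¹ * (psi f - psi k * h) := fun n h h0 hle =>
    miseReal_of_sqBias_eq_zero hf hk n
      ((hb h h0).2 ((ENNReal.ofReal_le_iff_le_toReal htop).1 hle))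
  refine ⟨htop, fun n hn => ?_, fun h₀ hh₀ => ?_, fun n hn => ?_, fun n hn h h0 hle => ?_,
    fun h hpos hle => ?_⟩
  · obtain ⟨h, hh⟩ := exists_forall_miseReal_le hf hk hpsi hn
    exact ⟨h, (hopt n hn h).2 hh⟩
  · exact tendsto_of_forall_miseReal_le hf hk hpsi hb fun n hn => (hopt n hn _).1 (hh₀ n hn)
  · have hiff : ∀ h : ℝ, 0 ≤ h → (isb P X f k n h = 0 ↔ h ≤ b.toReal) := by
      intro h h0
      rw [isb_eq hf hk hX_law hn h0, ENNReal.ofReal_eq_zero, ← hb h h0]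
      exact ⟨fun hle => hle.antisymm (sqBias_nonneg f k h), fun he => he.le⟩
    refine le_antisymm (sSup_le ?_) (le_sSup ?_)
    · rintro _ ⟨h, ⟨h0, hz⟩, rfl⟩
      exact (ENNReal.ofReal_le_iff_le_toReal htop).2 ((hiff h h0).1 hz)
    · exact ⟨b.toReal, ⟨ENNReal.toReal_nonneg, (hiff _ ENNReal.toReal_nonneg).2 le_rfl⟩,
        ENNReal.ofReal_toReal htop⟩
  · rw [hmise n hn h h0]
    exact ⟨ENNReal.ofReal_ne_top, by
      rw [ENNReal.toReal_ofReal (miseReal_nonneg hf hk n h0), hexact n h h0 hle]⟩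
  · have hz := (hb h hpos.le).2 ((ENNReal.ofReal_le_iff_le_toReal htop).1 hle)
    have hV := intVar_pos hf hk hpos
    rw [intVar, hz, crossBias_eq_zero hf hk hz, add_zero, sub_zero] at hV
    have hlt : psi f - psi k * h < psi f := sub_lt_self _ (mul_pos hpsi hpos)
    refine ⟨hV, hlt, fun n hn => ?_⟩
    have hn' : (0 : ℝ) < (n : ℝ)⁻¹ := by positivity
    rw [hmise n hn h hpos.le, hmise n hn 0 le_rfl, hexact n h hpos.le hle, miseReal_zero hf hk,
      ENNReal.ofReal_lt_ofReal_iff (mul_pos hn' (hV.trans hlt))]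
    exact mul_lt_mul_of_pos_left hlt hn'
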